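/- **Setting.** Let $k:\mathbb R^d\times\mathbb R^d\to\mathbb R$ be a symmetric positive definite kernel (all Gram matrices are positive semidefinite) and let $V:\mathbb R^d\to\mathbb R$ satisfy $\int e^{-V}<\infty$; assume that $k$ and $V$ are $C^3$. Let $\pi$ be the probability measure with density proportional to $e^{-V}$. Let $\mathcal H_0$ be the reproducing kernel Hilbert space of $k$ and $\mathcal H=\mathcal H_0^d$, with $\|\phi\|_{\mathcal H}^2=\sum_i\|\phi_i\|_{\mathcal H_0}^2$. The kernelized Stein discrepancy of a probability measure $Q$ on $\mathbb R^d$ is $$\mathsf{KSD}(Q\|\pi)=\sup\Big\{\int\big(-\nabla V\cdot\phi+\nabla\cdot\phi\big)\,dQ:\ \phi\in\mathcal H,\ \|\phi\|_{\mathcal H}\le 1\Big\}.$$ For $N\ge1$, the $N$-particle continuous-time SVGD dynamics on $(\mathbb R^d)^N$ are $$\dot x_i(t)=-\frac1N\sum_{j=1}^N k(x_i(t),x_j(t))\nabla V(x_j(t))+\frac1N\sum_{j=1}^N\nabla_2k(x_i(t),x_j(t)),\qquad 1\le i\le N,\ t\ge 0,$$ where the driving vector field is assumed to be complete and the initial configuration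 $(x_1(0),\dots,x_N(0))$ is random with a $C^1$ joint density. Let $p^N(t)$ be the joint law of $(x_1(t),\dots,x_N(t))$, let $\mu^N(t)=\frac1N\sum_{i=1}^N\delta_{x_i(t)}$ and $\mu^N_{av}=\frac1N\int_0^N\mu^N(t)\,dt$, and let $$C^*(z)=\nabla_2k(z,z)\cdot\nabla V(z)+k(z,z)\Delta V(z)-\Delta_2k(z,z),$$ where $\nabla_2k(z,z)=\nabla(k(z,\cdot))(z)$ and $\Delta_2k(z,z)=\Delta(k(z,\cdot))(z)$. Write $\mathsf{KL}(\cdot\|\cdot)\in[0,\infty]$ for the relative entropy. **Theorem.** (1) For every $N\ge1$ and $T>0$, $$\frac1T\int_0^T\mathbb E\big[\mathsf{KSD}^2(\mu^N(t)\|\pi)\big]dt\le\frac{\mathsf{KL}(p^N(0)\|\pi^{\otimes N})}{NT}+\frac1{N^2T}\int_0^T\mathbb E\Big[\sum_{k=1}^NC^*(x_k(t))\Big]dt$$ and $$\mathsf{KL}(p^N(T)\|\pi^{\otimes N})\le\mathsf{KL}(p^N(0)\|\pi^{\otimes N})+\frac1N\int_0^T\mathbb E\Big[\sum_{k=1}^NC^*(x_k(t))\Big]dt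 .$$ Here $\int_0^T\mathbb E[f(t)]\,dt$ stands for $\int_0^T\mathbb E[f(t)^+]\,dt-\int_0^T\mathbb E[f(t)^-]\,dt$, and the bounds are asserted in $[-\infty,\infty]$ whenever their right-hand sides are not of the form $\infty-\infty$. (2) Suppose that the above holds for every $N\ge 1$ with the same $k$ and $V$, that $C^*:=\sup_{z\in\mathbb R^d}C^*(z)<\infty$, and that $\limsup_{N\to\infty}\mathsf{KL}(p^N(0)\|\pi^{\otimes N})/N<\infty$. Then for every $N\ge1$ $$\big(\mathbb E[\mathsf{KSD}(\mu^N_{av}\|\pi)]\big)^2\le\frac1N\int_0^N\mathbb E\big[\mathsf{KSD}^2(\mu^N(t)\|\pi)\big]dt\le\frac{\sup_{L\ge1}\frac{\mathsf{KL}(p^L(0)\|\pi^{\otimes L})}{L}+C^*}{N},$$ and in particular $\mathbb E[\mathsf{KSD}(\mu^N_{av}\|\pi)]=O(1/\sqrt N)$ as $N\to\infty$. -/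

import Mathlib

open MeasureTheory Set Filter InformationTheory
open scoped ENNReal Topology RealInnerProductSpace Laplacian

noncomputable section

namespace SVGD

/-- The space `ℝ^d` with its Euclidean norm. -/
abbrev E (d : ℕ) : Type := EuclideanSpace ℝ (Fin d)

/-- A symmetric positive definite kernel on `X`, in the sense of the theory of reproducing kernels
(all Gram matrices are positive semidefinite). -/
structure PDKernel (X : Type*) where
  /-- the kernel function -/
  toFun : X → X → ℝ
  symm : ∀ x y, toFun x y = toFun y x
  nonneg : ∀ (s : Finset X) (c : X → ℝ), 0 ≤ ∑ x ∈ s, ∑ y ∈ s, c x * c y * toFun x y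

instance {X : Type*} : CoeFun (PDKernel X) (fun _ => X → X → ℝ) := ⟨PDKernel.toFun⟩

namespace PDKernel

variable {X : Type*} (k : PDKernel X)

/-- The kernel as a matrix of (scalar) operators on `ℝ`. -/
def matrix : Matrix X X (ℝ →L[ℝ] ℝ) :=
  Matrix.of fun x y => k x y • (1 : ℝ →L[ℝ] ℝ)

theorem matrix_posSemidef : k.matrix.PosSemidef := by
  have hH : k.matrix.IsHermitian := by
    ext x y
    simp [matrix, Matrix.conjTranspose_apply, k.symm x y]
  have h2 : ∀ c : X →₀ ℝ, 0 ≤ RCLike.re (c.sum fun x w => c.sum fun x' w' =>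
      inner ℝ (k.matrix x' x w) w') := by
    intro c
    have h := k.nonneg c.support c
    rw [Finset.sum_comm] at h
    simp only [RCLike.re_to_real, Finsupp.sum]
    refine h.trans_eq (Finset.sum_congr rfl fun x _ => Finset.sum_congr rfl fun y _ => ?_)
    simp [matrix]
    ring
  have h3 := (RKHS.posSemidef_tfae (K := k.matrix)).out 2 0
  exact h3.mp ⟨hH, h2⟩

instance : Fact k.matrix.PosSemidef := ⟨k.matrix_posSemidef⟩

/-- The reproducing kernel Hilbert space `ℋ₀` of real-valued functions on `X` with kernel `k`. -/
abbrev H₀ : Type _ := RKHS.OfKernel k.matrix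

end PDKernel

variable {d : ℕ}

/-- The Hilbert space `ℋ = ℋ₀ × ⋯ × ℋ₀` (`d` factors) with `‖φ‖² = ∑ i, ‖φ i‖²`. -/
abbrev VecRKHS (k : PDKernel (E d)) : Type := PiLp 2 (fun _ : Fin d => k.H₀)

/-- The `ℝ^d`-valued function `x ↦ (φ₁(x), …, φ_d(x))` represented by `φ ∈ ℋ`. -/
def VecRKHS.eval {k : PDKernel (E d)} (φ : VecRKHS k) (x : E d) : E d :=
  WithLp.toLp 2 fun i => φ i x

/-- The divergence `∇ · f`. -/
def divergence (f : E d → E d) (x : E d) : ℝ :=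
  ∑ i : Fin d, fderiv ℝ f x (EuclideanSpace.single i 1) i

/-- The Langevin–Stein operator `-∇V · f + ∇ · f` of `π ∝ exp (-V)`. -/
def steinOp (V : E d → ℝ) (f : E d → E d) (x : E d) : ℝ :=
  -⟪gradient V x, f x⟫ + divergence f x

/-- The kernelized Stein discrepancy of `Q` with respect to `π ∝ exp (-V)`: the supremum over the
unit ball of `ℋ` of the expectation of the Stein operator under `Q`. Truncating at `0` does not
change the supremum, since `φ = 0` contributes the value `0`. -/
def KSD (k : PDKernel (E d)) (V : E d → ℝ) (Q : Measure (E d)) : ℝ≥0∞ :=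
  ⨆ (φ : VecRKHS k) (_ : ‖φ‖ ≤ 1), ENNReal.ofReal (∫ x, steinOp V φ.eval x ∂Q)

/-- The target probability measure `π ∝ exp (-V)`. -/
def target (V : E d → ℝ) : Measure (E d) := (volume : Measure (E d)).tilted fun x => -V x

/-- The vector field on `(ℝ^d)^N` driving the `N`-particle SVGD dynamics. -/
def svgdField (k : PDKernel (E d)) (V : E d → ℝ) (N : ℕ) (z : Fin N → E d) : Fin N → E d :=
  fun i => -((1 / (N : ℝ)) • ∑ j, k (z i) (z j) • gradient V (z j))
    + (1 / (N : ℝ)) • ∑ j, gradient (k (z i)) (z j)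

/-- Completeness of a vector field: through every point there is an integral curve defined for
all times. -/
def IsCompleteField {F : Type*} [NormedAddCommGroup F] [NormedSpace ℝ F] (v : F → F) : Prop :=
  ∀ z, ∃ γ : ℝ → F, γ 0 = z ∧ IsIntegralCurve γ (fun _ => v)

/-- `x` is a continuous-time `N`-particle SVGD system on the probability space `(Ω, P)`: the driving
field is complete, the initial configuration is random with a `C¹` density, and almost every
trajectory solves the SVGD equations for all times `t ≥ 0`. -/
structure IsSVGD (k : PDKernel (E d)) (V : E d → ℝ) (N : ℕ) {Ω : Type*} [MeasurableSpace Ω]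
    (P : Measure Ω) (x : ℝ → Ω → Fin N → E d) : Prop where
  complete : IsCompleteField (svgdField k V N)
  aemeasurable_init : AEMeasurable (x 0) P
  density : ∃ p₀ : (Fin N → E d) → ℝ, ContDiff ℝ 1 p₀ ∧ (∀ z, 0 ≤ p₀ z) ∧
    P.map (x 0) = volume.withDensity fun z => ENNReal.ofReal (p₀ z)
  solution : ∀ᵐ ω ∂P, IsIntegralCurveOn (fun t => x t ω) (fun _ => svgdField k V N) (Ici 0)

/-- The empirical measure `(1/N) ∑ i, δ_{z i}`. -/
def empirical {N : ℕ} (z : Fin N → E d) : Measure (E d) :=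
  (N : ℝ≥0∞)⁻¹ • ∑ i, Measure.dirac (z i)

/-- The time average `(1/N) ∫₀ᴺ μ(t) dt` of the empirical measures of a path of `N` particles. -/
def timeAverage {N : ℕ} (γ : ℝ → Fin N → E d) : Measure (E d) :=
  (N : ℝ≥0∞)⁻¹ • (volume.restrict (Icc (0 : ℝ) N)).bind fun t => empirical (γ t)

/-- The function `C*(z) = ∇₂k(z,z) · ∇V(z) + k(z,z) ΔV(z) - Δ₂k(z,z)`. -/
def Cstar (k : PDKernel (E d)) (V : E d → ℝ) (z : E d) : ℝ :=
  ⟪gradient (k z) z, gradient V z⟫ + k z z * Δ V z - Δ (k z) z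

/-- `KL (p^N(t) ‖ π^{⊗N})`, the relative entropy of the joint law at time `t`. -/
def entropy (V : E d → ℝ) {N : ℕ} {Ω : Type*} [MeasurableSpace Ω]
    (P : Measure Ω) (x : ℝ → Ω → Fin N → E d) (t : ℝ) : ℝ≥0∞ :=
  klDiv (P.map (x t)) (Measure.pi fun _ : Fin N => target V)

/-- `∫₀ᵀ 𝔼[KSD²(μ^N(t) ‖ π)] dt`. -/
def ksdSqIntegral (k : PDKernel (E d)) (V : E d → ℝ) {N : ℕ} {Ω : Type*} [MeasurableSpace Ω]
    (P : Measure Ω) (x : ℝ → Ω → Fin N → E d) (T : ℝ) : ℝ≥0∞ :=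
  ∫⁻ t in Icc 0 T, ∫⁻ ω, KSD k V (empirical (x t ω)) ^ 2 ∂P

/-- `∫₀ᵀ 𝔼[f(t)⁺] dt`. -/
def posIntegral {Ω : Type*} [MeasurableSpace Ω] (P : Measure Ω) (T : ℝ) (f : ℝ → Ω → ℝ) : ℝ≥0∞ :=
  ∫⁻ t in Icc 0 T, ∫⁻ ω, ENNReal.ofReal (f t ω) ∂P

/-- `∫₀ᵀ 𝔼[f(t)] dt = ∫₀ᵀ 𝔼[f(t)⁺] dt - ∫₀ᵀ 𝔼[f(t)⁻] dt`, with values in `[-∞, ∞]`; meaningful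
unless both terms are infinite. -/
def timeExpectation {Ω : Type*} [MeasurableSpace Ω] (P : Measure Ω) (T : ℝ) (f : ℝ → Ω → ℝ) :
    EReal :=
  (posIntegral P T f : EReal) - (posIntegral P T (fun t ω => -f t ω) : EReal)

/-- The random variables `∑ i, C*(x_i(t))`. -/
def CstarSum (k : PDKernel (E d)) (V : E d → ℝ) {N : ℕ} {Ω : Type*}
    (x : ℝ → Ω → Fin N → E d) (t : ℝ) (ω : Ω) : ℝ :=
  ∑ i, Cstar k V (x t ω i)

end SVGD

end

/-! The relative entropy with respect to $\pi^{\otimes N}$ satisfies an exact balance along the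
particle flow, and each bound of (1) drops one nonnegative term from it. Let $w$ be the density of
$\pi^{\otimes N}$ and $v$ the driving field. Then $\nabla\cdot(wv)=wg$ with
$g(z)=N\,\mathsf{KSD}^2(\mu_z\|\pi)-\frac1N\sum_iC^*(z_i)$, where $\mu_z$ is the empirical measure
of $z$ (`divergenceOf_density_smul_svgdField`). Differentiating the first slot of each pair
interaction produces the double sum of the Stein kernel, which is $N^2\,\mathsf{KSD}^2$
(`KSD_empirical_sq`). Particle $i$ also occupies the second slot of its interaction with itself, and
that diagonal term produces $-C^*$.

By Liouville's theorem in weak form (`map_flow_withDensity`), the flow at time $T$ carries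
$e^{\int_0^Tg}\,\pi^{\otimes N}$ to $\pi^{\otimes N}$. Hence the logarithm of the relative density
falls by $\int_0^Tg$ along each trajectory, and integrating against the initial law gives the
balance (`klDiv_map_add`, `IsSVGD.entropy_balance`). Positive and negative parts stay on opposite
sides, so the identity holds in $[0,\infty]$ without integrability assumptions.

Two points of regularity need care. The feature map $x\mapsto k(x,\cdot)$ is differentiable into the
Hilbert space because its Gram function is $C^2$ (`differentiableAt_of_gram`). The flow is only
shown to be locally Lipschitz in the initial point and is never differentiated there: Liouville's
theorem is tested on Lipschitz functions, with Rademacher's theorem at time $0$ and the group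
property elsewhere.

For (2), the balance is used at $T=N$ with $C^*$ bounded above, and the time average is controlled
by convexity of the discrepancy in the measure and by Cauchy–Schwarz. -/

open MeasureTheory Set Filter InformationTheory
open scoped ENNReal Topology RealInnerProductSpace Laplacian

noncomputable section

namespace SVGD

/-! ### Differentiability of a Hilbert-space map from its Gram function -/

section FeatureMap

variable {X : Type*} [NormedAddCommGroup X] [NormedSpace ℝ X]

/-- Mean value inequality in the second variable alone: the partial derivative `D` is $C^1$, hence
strictly differentiable at the diagonal point, so $D(x+h,y)-D(x,y)$ is linear in $h$ up to
$\varepsilon\|h\|$ for $y$ near $x$. The error is a product $\|h\|\|h'\|$, which survives division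
by two independent increments. -/
theorem exists_bilin_mixedDifference_le {κ : X → X → ℝ}
    (hκ : ContDiff ℝ 2 fun p : X × X => κ p.1 p.2) (x : X) :
    ∃ B : X →L[ℝ] X →L[ℝ] ℝ, ∀ ε > 0, ∃ δ > 0, ∀ h h' : X, ‖h‖ < δ → ‖h'‖ < δ →
      |κ (x + h) (x + h') - κ (x + h) x - κ x (x + h') + κ x x - B h h'| ≤ ε * ‖h‖ * ‖h'‖ := by
  set f : X × X → ℝ := fun p => κ p.1 p.2 with hf
  set D : X × X → X →L[ℝ] ℝ := fun p => (fderiv ℝ f p).comp (ContinuousLinearMap.inr ℝ X X) with hD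
  have hD1 : ContDiff ℝ 1 D := (hκ.fderiv_right (m := 1) (by norm_num)).clm_comp contDiff_const
  have hder : ∀ a b, HasFDerivAt (κ a) (D (a, b)) b := by
    intro a b
    have h1 : HasFDerivAt f (fderiv ℝ f (a, b)) (a, b) :=
      (hκ.differentiable (by norm_num) _).hasFDerivAt
    exact h1.comp b (hasFDerivAt_prodMk_right a b)
  have hs : HasStrictFDerivAt D (fderiv ℝ D (x, x)) (x, x) :=
    hD1.contDiffAt.hasStrictFDerivAt (by norm_num)
  refine ⟨(fderiv ℝ D (x, x)).comp (ContinuousLinearMap.inl ℝ X X), fun ε hε => ?_⟩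
  have h1 := hs.isLittleO.def hε
  obtain ⟨δ, hδ, h2⟩ := Metric.eventually_nhds_iff.1 h1
  refine ⟨δ, hδ, fun h h' hh hh' => ?_⟩
  have key : ∀ y ∈ Metric.ball x δ,
      HasFDerivWithinAt (fun y => κ (x + h) y - κ x y - fderiv ℝ D (x, x) (h, 0) y)
        (D (x + h, y) - D (x, y) - fderiv ℝ D (x, x) (h, 0)) (Metric.ball x δ) y := fun y _ =>
    (((hder (x + h) y).sub (hder x y)).sub
      (fderiv ℝ D (x, x) (h, 0)).hasFDerivAt).hasFDerivWithinAt
  have bound : ∀ y ∈ Metric.ball x δ,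
      ‖D (x + h, y) - D (x, y) - fderiv ℝ D (x, x) (h, 0)‖ ≤ ε * ‖h‖ := by
    intro y hy
    have h3 := @h2 ((x + h, y), (x, y)) (by
      rw [Metric.mem_ball] at hy
      simp [Prod.dist_eq, hy, hh])
    simpa [Prod.norm_def] using h3
  have h4 := (convex_ball x δ).norm_image_sub_le_of_norm_hasFDerivWithin_le key bound
    (Metric.mem_ball_self hδ) (y := x + h') (by simpa using hh')
  simp only [Real.norm_eq_abs, add_sub_cancel_left, map_add] at h4
  refine le_trans (le_of_eq ?_) h4
  congr 1
  simp only [ContinuousLinearMap.comp_apply, ContinuousLinearMap.inl_apply]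
  ring

/-- Inner products of difference quotients along $e$ and $e'$ tend to $B(e,e')$, so the quotients
along $e$ are Cauchy: $\|u_n-u_m\|^2\to B-2B+B=0$. Their limits $L e$ have Gram form $B$, and
bilinearity of $B$ makes $\|L(a+b)-La-Lb\|^2$ vanish, so $L$ is linear. It is the derivative. -/
theorem differentiableAt_of_gram [FiniteDimensional ℝ X]
    {H : Type*} [NormedAddCommGroup H] [InnerProductSpace ℝ H] [CompleteSpace H]
    {K : X → H} {x : X} (B : X →L[ℝ] X →L[ℝ] ℝ)
    (hB : ∀ ε > 0, ∃ δ > 0, ∀ h h' : X, ‖h‖ < δ → ‖h'‖ < δ →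
      |⟪K (x + h) - K x, K (x + h') - K x⟫ - B h h'| ≤ ε * ‖h‖ * ‖h'‖) :
    DifferentiableAt ℝ K x := by
  set u : X → ℕ → H := fun e n => ((n : ℝ) + 1) • (K (x + ((n : ℝ) + 1)⁻¹ • e) - K x) with hu
  have hsmall : ∀ e : X, Tendsto (fun n : ℕ => ((n : ℝ) + 1)⁻¹ • e) atTop (𝓝 0) := by
    intro e
    have h := (tendsto_one_div_add_atTop_nhds_zero_nat (𝕜 := ℝ)).smul_const e
    simpa [one_div] using h
  have hsmall' : ∀ (e : X) {δ : ℝ}, 0 < δ → ∀ᶠ n : ℕ in atTop, ‖((n : ℝ) + 1)⁻¹ • e‖ < δ := by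
    intro e δ hδ
    have := (hsmall e).norm
    rw [norm_zero] at this
    exact this.eventually_lt_const hδ
  have hpos : ∀ n : ℕ, (0 : ℝ) < (n : ℝ) + 1 := fun n => by positivity
  -- inner products of difference quotients with increments
  have hun : ∀ (e h' : X) (n : ℕ), ⟪u e n, K (x + h') - K x⟫ - B e h' =
      ((n : ℝ) + 1) * (⟪K (x + ((n : ℝ) + 1)⁻¹ • e) - K x, K (x + h') - K x⟫
        - B (((n : ℝ) + 1)⁻¹ • e) h') := by
    intro e h' n
    have := (hpos n).ne'
    simp only [hu, real_inner_smul_left, map_smul, FunLike.coe_smul, Pi.smul_apply, smul_eq_mul]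
    field_simp
  have huu : ∀ (e e' : X), Tendsto (fun p : ℕ × ℕ => ⟪u e p.1, u e' p.2⟫) (atTop ×ˢ atTop) (𝓝 (B e e')) := by
    intro e e'
    rw [Metric.tendsto_nhds]
    intro ε hε
    obtain ⟨δ, hδ, h⟩ := hB (ε / (‖e‖ * ‖e'‖ + 1)) (by positivity)
    have h1 : ∀ᶠ p : ℕ × ℕ in atTop ×ˢ atTop, ‖((p.1 : ℝ) + 1)⁻¹ • e‖ < δ :=
      tendsto_fst.eventually (hsmall' e hδ)
    have h2 : ∀ᶠ p : ℕ × ℕ in atTop ×ˢ atTop, ‖((p.2 : ℝ) + 1)⁻¹ • e'‖ < δ :=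
      tendsto_snd.eventually (hsmall' e' hδ)
    filter_upwards [h1, h2] with p hp1 hp2
    have h3 := h _ _ hp1 hp2
    have e1 : ⟪u e p.1, u e' p.2⟫ - B e e' = ((p.1 : ℝ) + 1) * ((p.2 : ℝ) + 1) *
        (⟪K (x + ((p.1 : ℝ) + 1)⁻¹ • e) - K x, K (x + ((p.2 : ℝ) + 1)⁻¹ • e') - K x⟫ -
          B (((p.1 : ℝ) + 1)⁻¹ • e) (((p.2 : ℝ) + 1)⁻¹ • e')) := by
      have a1 := (hpos p.1).ne'
      have a2 := (hpos p.2).ne'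
      simp only [hu, real_inner_smul_left, real_inner_smul_right, map_smul, FunLike.coe_smul,
        Pi.smul_apply, smul_eq_mul]
      field_simp
    rw [Real.dist_eq, e1, abs_mul, abs_of_pos (mul_pos (hpos p.1) (hpos p.2))]
    have h4 : ((p.1 : ℝ) + 1) * ((p.2 : ℝ) + 1) * (ε / (‖e‖ * ‖e'‖ + 1) *
        ‖((p.1 : ℝ) + 1)⁻¹ • e‖ * ‖((p.2 : ℝ) + 1)⁻¹ • e'‖) =
        ε * ((‖e‖ * ‖e'‖) / (‖e‖ * ‖e'‖ + 1)) := by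
      have a1 := (hpos p.1).ne'
      have a2 := (hpos p.2).ne'
      rw [norm_smul, norm_smul, norm_inv, norm_inv, Real.norm_of_nonneg (hpos p.1).le,
        Real.norm_of_nonneg (hpos p.2).le]
      field_simp
    calc _ ≤ ((p.1 : ℝ) + 1) * ((p.2 : ℝ) + 1) * (ε / (‖e‖ * ‖e'‖ + 1) *
        ‖((p.1 : ℝ) + 1)⁻¹ • e‖ * ‖((p.2 : ℝ) + 1)⁻¹ • e'‖) :=
          mul_le_mul_of_nonneg_left h3 (mul_pos (hpos p.1) (hpos p.2)).le
      _ = _ := h4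
      _ < ε * 1 := by
          refine mul_lt_mul_of_pos_left ?_ hε
          rw [div_lt_one (by positivity)]
          linarith
      _ = ε := mul_one ε
  clear_value u
  have hcauchy : ∀ e, CauchySeq (u e) := by
    intro e
    rw [cauchySeq_iff_tendsto_dist_atTop_0]
    rw [← prod_atTop_atTop_eq]
    have d1 : Tendsto (fun p : ℕ × ℕ => ⟪u e p.1, u e p.1⟫) (atTop ×ˢ atTop) (𝓝 (B e e)) :=
      (huu e e).comp (tendsto_fst.prodMk tendsto_fst)
    have d2 : Tendsto (fun p : ℕ × ℕ => ⟪u e p.2, u e p.2⟫) (atTop ×ˢ atTop) (𝓝 (B e e)) :=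
      (huu e e).comp (tendsto_snd.prodMk tendsto_snd)
    have d3 := ((d1.sub ((huu e e).const_mul 2)).add d2).sqrt
    rw [show B e e - 2 * B e e + B e e = 0 by ring, Real.sqrt_zero] at d3
    refine d3.congr fun p => ?_
    rw [dist_eq_norm, real_inner_self_eq_norm_sq, real_inner_self_eq_norm_sq, ← norm_sub_sq_real,
      Real.sqrt_sq (norm_nonneg _)]
  choose L hL using fun e => cauchySeq_tendsto_of_complete (hcauchy e)
  have hLL : ∀ e e', ⟪L e, L e'⟫ = B e e' := by
    intro e e'
    refine tendsto_nhds_unique ((hL e).inner (hL e')) ?_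
    have h1 : Tendsto (fun n : ℕ => (n, n)) atTop (atTop ×ˢ atTop) :=
      tendsto_id.prodMk tendsto_id
    exact (huu e e').comp h1
  have hzero : ∀ w : H, ⟪w, w⟫ = 0 → w = 0 := fun w hw => inner_self_eq_zero.1 hw
  let Llin : X →ₗ[ℝ] H :=
    { toFun := L
      map_add' := by
        intro a b
        rw [← sub_eq_zero]
        apply hzero
        simp only [inner_sub_left, inner_sub_right, inner_add_left, inner_add_right, hLL, map_add,
          FunLike.coe_add, Pi.add_apply]
        ring
      map_smul' := by
        intro c a
        rw [← sub_eq_zero]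
        apply hzero
        simp only [inner_sub_left, inner_sub_right, real_inner_smul_left, real_inner_smul_right,
          hLL, map_smul, FunLike.coe_smul, Pi.smul_apply, smul_eq_mul, RingHom.id_apply]
        ring }
  have hLK : ∀ ε > 0, ∃ δ > 0, ∀ e h' : X, ‖h'‖ < δ →
      |⟪L e, K (x + h') - K x⟫ - B e h'| ≤ ε * ‖e‖ * ‖h'‖ := by
    intro ε hε
    obtain ⟨δ, hδ, h⟩ := hB ε hε
    refine ⟨δ, hδ, fun e h' hh' => ?_⟩
    have h1 : Tendsto (fun n => |⟪u e n, K (x + h') - K x⟫ - B e h'|) atTop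
        (𝓝 |⟪L e, K (x + h') - K x⟫ - B e h'|) :=
      (((hL e).inner tendsto_const_nhds).sub_const _).abs
    refine le_of_tendsto h1 ?_
    filter_upwards [hsmall' e hδ] with n hn
    rw [hun, abs_mul, abs_of_pos (hpos n)]
    calc _ ≤ ((n : ℝ) + 1) * (ε * ‖((n : ℝ) + 1)⁻¹ • e‖ * ‖h'‖) :=
          mul_le_mul_of_nonneg_left (h _ _ hn hh') (hpos n).le
      _ = ε * ‖e‖ * ‖h'‖ := by
          have a1 := (hpos n).ne'
          rw [norm_smul, norm_inv, Real.norm_of_nonneg (hpos n).le]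
          field_simp
  have hfd : HasFDerivAt K (LinearMap.toContinuousLinearMap Llin) x := by
    rw [hasFDerivAt_iff_isLittleO_nhds_zero, Asymptotics.isLittleO_iff]
    intro c hc
    -- With $\Delta=K(x+h)-K(x)$, the squared remainder is
    -- $(\langle\Delta,\Delta\rangle-B(h,h))-2(\langle Lh,\Delta\rangle-B(h,h))$: three errors in
    -- all, each allowed $\frac{c^2}3\|h\|^2$.
    obtain ⟨δ₁, hδ₁, h1⟩ := hB (c ^ 2 / 3) (by positivity)
    obtain ⟨δ₂, hδ₂, h2⟩ := hLK (c ^ 2 / 3) (by positivity)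
    filter_upwards [Metric.ball_mem_nhds (0 : X) (lt_min hδ₁ hδ₂)] with h hh
    rw [mem_ball_zero_iff, lt_min_iff] at hh
    have a1 := h1 h h hh.1 hh.1
    have a2 := h2 h h hh.2
    have a3 := hLL h h
    rw [abs_le] at a1 a2
    refine abs_le_of_sq_le_sq' ?_ (by positivity) |>.2
    change ‖K (x + h) - K x - L h‖ ^ 2 ≤ _
    rw [norm_sub_sq_real, ← real_inner_self_eq_norm_sq, ← real_inner_self_eq_norm_sq, a3,
      real_inner_comm (L h)]
    nlinarith [a1.1, a1.2, a2.1, a2.2]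
  exact hfd.differentiableAt

end FeatureMap

/-! ### The Stein kernel and the discrepancy of empirical measures -/

variable {d : ℕ}

theorem gradient_apply {f : E d → ℝ} (x : E d) (a : Fin d) :
    gradient f x a = fderiv ℝ f x (EuclideanSpace.single a 1) := by
  have h := InnerProductSpace.toDual_symm_apply (𝕜 := ℝ) (x := EuclideanSpace.single a (1 : ℝ))
    (y := fderiv ℝ f x)
  rw [← h, EuclideanSpace.inner_single_right]
  simp [gradient]

theorem contDiff_gradient {f : E d → ℝ} {n : ℕ} (hf : ContDiff ℝ (n + 1) f) :
    ContDiff ℝ n (gradient f) :=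
  (InnerProductSpace.toDual ℝ (E d)).symm.toContinuousLinearEquiv.contDiff.comp
    (hf.fderiv_right (m := n) le_rfl)

theorem contDiff_gradient_snd {f : E d → E d → ℝ} {n : ℕ}
    (hf : ContDiff ℝ (n + 1) fun p : E d × E d => f p.1 p.2) :
    ContDiff ℝ n fun p : E d × E d => gradient (f p.1) p.2 := by
  refine (InnerProductSpace.toDual ℝ (E d)).symm.toContinuousLinearEquiv.contDiff.comp ?_
  refine ContDiff.fderiv (m := n + 1) (n := n) (f := fun p : E d × E d => f p.1) ?_ (contDiff_snd (𝕜 := ℝ)) le_rfl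
  have h : ContDiff ℝ (n + 1) fun q : (E d × E d) × E d => (q.1.1, q.2) := by fun_prop
  exact hf.comp h

/-- The interaction of two particles: the driving field of the particle system is
`z ↦ (1/N) ∑ j, interaction k V (z i) (z j)`. -/
def interaction (k : PDKernel (E d)) (V : E d → ℝ) (x y : E d) : E d :=
  -(k x y • gradient V y) + gradient (k x) y

/-- The Stein kernel, obtained by applying the Stein operator to both arguments of `k`. -/
def steinKernel (k : PDKernel (E d)) (V : E d → ℝ) (x y : E d) : ℝ :=
  steinOp V (fun x => interaction k V x y) x

theorem svgdField_apply (k : PDKernel (E d)) (V : E d → ℝ) (N : ℕ) (z : Fin N → E d) (i : Fin N) :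
    svgdField k V N z i = (1 / (N : ℝ)) • ∑ j, interaction k V (z i) (z j) := by
  simp [svgdField, interaction, Finset.sum_add_distrib, smul_add]

variable {k : PDKernel (E d)} {V : E d → ℝ}

theorem contDiff_interaction (hk : ContDiff ℝ 3 fun p : E d × E d => k p.1 p.2)
    (hV : ContDiff ℝ 3 V) :
    ContDiff ℝ 2 fun p : E d × E d => interaction k V p.1 p.2 :=
  (((hk.of_le (by norm_num)).smul
    ((contDiff_gradient (n := 2) (by exact_mod_cast hV)).comp contDiff_snd)).neg).add
      (contDiff_gradient_snd (n := 2) (by exact_mod_cast hk))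

theorem contDiff_svgdField (hk : ContDiff ℝ 3 fun p : E d × E d => k p.1 p.2)
    (hV : ContDiff ℝ 3 V) (N : ℕ) : ContDiff ℝ 2 (svgdField k V N) := by
  rw [contDiff_pi]
  intro i
  simp only [svgdField_apply]
  refine ContDiff.const_smul _ (ContDiff.sum fun j _ => ?_)
  have h : ContDiff ℝ 2 fun z : Fin N → E d => (z i, z j) := by fun_prop
  exact (contDiff_interaction hk hV).comp h

theorem continuous_steinKernel (hk : ContDiff ℝ 3 fun p : E d × E d => k p.1 p.2)
    (hV : ContDiff ℝ 3 V) : Continuous fun p : E d × E d => steinKernel k V p.1 p.2 := by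
  have hA := contDiff_interaction hk hV
  have hg : Continuous (gradient V) :=
    (contDiff_gradient (n := 2) (by exact_mod_cast hV)).continuous
  have h1 : ContDiff ℝ 1 fun p : E d × E d =>
      fderiv ℝ (fun x => interaction k V x p.2) p.1 := by
    refine ContDiff.fderiv (m := 2) (n := 1) (f := fun (p : E d × E d) x => interaction k V x p.2) ?_
      (contDiff_fst (𝕜 := ℝ)) le_rfl
    have h : ContDiff ℝ 2 fun q : (E d × E d) × E d => (q.2, q.1.2) := by fun_prop
    exact hA.comp h
  refine ((hg.comp continuous_fst).inner hA.continuous).neg.add ?_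
  refine continuous_finsetSum _ fun a _ => ?_
  exact (EuclideanSpace.proj (𝕜 := ℝ) a).continuous.comp (h1.continuous.clm_apply continuous_const)

/-- The canonical feature map `x ↦ k(x, ·)`. -/
def feature (k : PDKernel (E d)) (x : E d) : k.H₀ := RKHS.kerFun k.H₀ x (1 : ℝ)

theorem inner_feature (x : E d) (f : k.H₀) : ⟪feature k x, f⟫ = f x := by
  rw [feature, RKHS.kerFun_inner]
  simp

theorem inner_feature_feature (x y : E d) : ⟪feature k x, feature k y⟫ = k x y := by
  rw [inner_feature, feature, RKHS.kerFun_apply, RKHS.OfKernel.kernel_ofKernel]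
  simp [PDKernel.matrix]

/-- By the reproducing property, inner products of increments of the feature map are exactly mixed
differences of `k`. -/
theorem differentiable_feature (hk : ContDiff ℝ 3 fun p : E d × E d => k p.1 p.2) :
    Differentiable ℝ (feature k) := by
  intro x
  obtain ⟨B, hB⟩ := exists_bilin_mixedDifference_le (κ := fun x y => k x y)
    (hk.of_le (by norm_num)) x
  refine differentiableAt_of_gram B fun ε hε => ?_
  obtain ⟨δ, hδ, h⟩ := hB ε hε
  refine ⟨δ, hδ, fun u u' hu hu' => ?_⟩
  convert h u u' hu hu' using 3
  simp only [inner_sub_left, inner_sub_right, inner_feature_feature]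
  ring

/-- The representer of the functional `φ ↦ steinOp V φ.eval x`. -/
def steinFeature (k : PDKernel (E d)) (V : E d → ℝ) (x : E d) : VecRKHS k :=
  WithLp.toLp 2 fun a => -(gradient V x a • feature k x) +
    fderiv ℝ (feature k) x (EuclideanSpace.single a 1)

theorem hasFDerivAt_eval (hk : ContDiff ℝ 3 fun p : E d × E d => k p.1 p.2) (f : k.H₀) (x : E d) :
    HasFDerivAt (fun x => f x) ((innerSL ℝ f).comp (fderiv ℝ (feature k) x)) x := by
  have h := (innerSL ℝ f).hasFDerivAt.comp x (differentiable_feature hk x).hasFDerivAt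
  refine h.congr_of_eventuallyEq (.of_forall fun y => ?_)
  simp [← inner_feature y f, real_inner_comm]

/-- The reproducing property and its derivative,
$\partial_af(x)=\langle\partial_ak(x,\cdot),f\rangle$, applied to each component. -/
theorem steinOp_eval (hk : ContDiff ℝ 3 fun p : E d × E d => k p.1 p.2) (φ : VecRKHS k) (x : E d) :
    steinOp V φ.eval x = ⟪steinFeature k V x, φ⟫ := by
  have h1 : ∀ a : Fin d, fderiv ℝ φ.eval x (EuclideanSpace.single a 1) a =
      ⟪fderiv ℝ (feature k) x (EuclideanSpace.single a 1), φ a⟫ := by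
    intro a
    have h2 : HasFDerivAt φ.eval (((PiLp.continuousLinearEquiv 2 ℝ (fun _ : Fin d => ℝ)).symm :
        (Fin d → ℝ) →L[ℝ] E d).comp (ContinuousLinearMap.pi fun a =>
          (innerSL ℝ (φ a)).comp (fderiv ℝ (feature k) x))) x :=
      ((PiLp.continuousLinearEquiv 2 ℝ (fun _ : Fin d => ℝ)).symm :
        (Fin d → ℝ) →L[ℝ] E d).hasFDerivAt.comp x
        (hasFDerivAt_pi.2 fun a => hasFDerivAt_eval hk (φ a) x)
    rw [h2.fderiv]
    simp [real_inner_comm]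
  simp only [steinOp, divergence, h1, steinFeature, PiLp.inner_apply, inner_add_left,
    inner_neg_left, real_inner_smul_left, inner_feature, Finset.sum_add_distrib,
    Finset.sum_neg_distrib]
  simp [VecRKHS.eval, mul_comm]

theorem eval_steinFeature (hk : ContDiff ℝ 3 fun p : E d × E d => k p.1 p.2) (x y : E d) :
    (steinFeature k V y).eval x = interaction k V x y := by
  ext a
  have h1 : HasFDerivAt (k x) ((innerSL ℝ (feature k x)).comp (fderiv ℝ (feature k) y)) y := by
    have h := (innerSL ℝ (feature k x)).hasFDerivAt.comp y (differentiable_feature hk y).hasFDerivAt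
    refine h.congr_of_eventuallyEq (.of_forall fun y => ?_)
    simp [inner_feature_feature]
  have h2 : gradient (k x) y a =
      ⟪feature k x, fderiv ℝ (feature k) y (EuclideanSpace.single a 1)⟫ := by
    rw [gradient_apply, h1.fderiv]
    simp
  simp only [interaction, VecRKHS.eval, steinFeature, ← inner_feature, inner_add_right,
    inner_neg_right, real_inner_smul_right, inner_feature_feature, PiLp.add_apply, PiLp.neg_apply,
    PiLp.smul_apply, h2, smul_eq_mul]
  ring

theorem inner_steinFeature (hk : ContDiff ℝ 3 fun p : E d × E d => k p.1 p.2) (x y : E d) :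
    ⟪steinFeature k V x, steinFeature k V y⟫ = steinKernel k V x y := by
  rw [← steinOp_eval hk, steinKernel]
  congr 1
  funext x
  exact eval_steinFeature hk x y

/-- The squared distance between two representers expands into values of the continuous Stein kernel
and vanishes on the diagonal. This makes the Stein operator of any $\phi\in\mathcal H$ continuous,
hence integrable along paths. -/
theorem continuous_steinFeature (hk : ContDiff ℝ 3 fun p : E d × E d => k p.1 p.2)
    (hV : ContDiff ℝ 3 V) : Continuous (steinFeature k V) := by
  have hh := continuous_steinKernel hk hV
  rw [continuous_iff_continuousAt]
  intro x
  rw [ContinuousAt, tendsto_iff_norm_sub_tendsto_zero]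
  have h1 : Continuous fun y => √(steinKernel k V y y - 2 * steinKernel k V y x
      + steinKernel k V x x) :=
    Real.continuous_sqrt.comp (((hh.comp (continuous_id.prodMk continuous_id)).sub
      (continuous_const.mul (hh.comp (continuous_id.prodMk continuous_const)))).add
        continuous_const)
  have h2 := h1.tendsto x
  rw [show steinKernel k V x x - 2 * steinKernel k V x x + steinKernel k V x x = 0 by ring,
    Real.sqrt_zero] at h2
  refine h2.congr fun y => ?_
  rw [← inner_steinFeature hk, ← inner_steinFeature hk, ← inner_steinFeature hk,
    real_inner_self_eq_norm_sq, real_inner_self_eq_norm_sq, ← norm_sub_sq_real,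
    Real.sqrt_sq (norm_nonneg _)]

theorem integral_empirical {N : ℕ} (z : Fin N → E d) (f : E d → ℝ) :
    ∫ x, f x ∂(empirical z) = (1 / (N : ℝ)) * ∑ i, f (z i) := by
  rw [empirical, integral_smul_measure, integral_finsetSum_measure]
  · simp
  · intro i _
    exact integrable_dirac (by simp)

/-- The squared kernelized Stein discrepancy of the empirical measure, as a `V`-statistic. -/
def steinEnergy (k : PDKernel (E d)) (V : E d → ℝ) {N : ℕ} (z : Fin N → E d) : ℝ :=
  (1 / (N : ℝ)) ^ 2 * ∑ i, ∑ j, steinKernel k V (z i) (z j)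

theorem norm_sq_mean_steinFeature (hk : ContDiff ℝ 3 fun p : E d × E d => k p.1 p.2)
    {N : ℕ} (z : Fin N → E d) :
    ‖(1 / (N : ℝ)) • ∑ i, steinFeature k V (z i)‖ ^ 2 = steinEnergy k V z := by
  rw [← real_inner_self_eq_norm_sq, real_inner_smul_left, real_inner_smul_right, sum_inner,
    steinEnergy]
  simp only [inner_sum, inner_steinFeature hk]
  ring

theorem steinEnergy_nonneg (hk : ContDiff ℝ 3 fun p : E d × E d => k p.1 p.2)
    {N : ℕ} (z : Fin N → E d) : 0 ≤ steinEnergy k V z := by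
  rw [← norm_sq_mean_steinFeature hk]
  positivity

theorem continuous_steinEnergy (hk : ContDiff ℝ 3 fun p : E d × E d => k p.1 p.2)
    (hV : ContDiff ℝ 3 V) (N : ℕ) : Continuous fun z : Fin N → E d => steinEnergy k V z := by
  have h : ∀ i j, Continuous fun z : Fin N → E d => steinKernel k V (z i) (z j) := by
    intro i j
    have h1 : Continuous fun z : Fin N → E d => ((z i, z j) : E d × E d) := by fun_prop
    have h2 := (continuous_steinKernel hk hV).comp h1
    exact h2
  unfold steinEnergy
  fun_prop

/-- Integration of the Stein operator is the inner product with the mean `m` of the representers, so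
the supremum is $\|m\|$, attained at $m/\|m\|$ when $m\ne0$. -/
theorem KSD_empirical (hk : ContDiff ℝ 3 fun p : E d × E d => k p.1 p.2)
    {N : ℕ} (z : Fin N → E d) :
    KSD k V (empirical z) = ENNReal.ofReal √(steinEnergy k V z) := by
  rw [← norm_sq_mean_steinFeature hk, Real.sqrt_sq (norm_nonneg _)]
  set m := (1 / (N : ℝ)) • ∑ i, steinFeature k V (z i) with hm
  have h : ∀ φ : VecRKHS k, ∫ x, steinOp V φ.eval x ∂(empirical z) = ⟪m, φ⟫ := by
    intro φ
    rw [integral_empirical, hm, real_inner_smul_left, sum_inner]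
    simp only [steinOp_eval hk]
  simp only [KSD, h]
  apply le_antisymm
  · refine iSup₂_le fun φ hφ => ENNReal.ofReal_le_ofReal ?_
    calc ⟪m, φ⟫ ≤ ‖m‖ * ‖φ‖ := real_inner_le_norm _ _
      _ ≤ ‖m‖ * 1 := by gcongr
      _ = ‖m‖ := mul_one _
  · rcases eq_or_ne m 0 with h0 | h0
    · simp [h0]
    · have hn : ‖m‖ ≠ 0 := norm_ne_zero_iff.2 h0
      refine le_iSup₂_of_le (‖m‖⁻¹ • m) ?_ ?_
      · rw [norm_smul, norm_inv, norm_norm, inv_mul_cancel₀ hn]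
      · rw [real_inner_smul_right, real_inner_self_eq_norm_sq, sq, inv_mul_cancel_left₀ hn]

theorem KSD_empirical_sq (hk : ContDiff ℝ 3 fun p : E d × E d => k p.1 p.2)
    {N : ℕ} (z : Fin N → E d) :
    KSD k V (empirical z) ^ 2 = ENNReal.ofReal (steinEnergy k V z) := by
  rw [KSD_empirical hk, ← ENNReal.ofReal_pow (Real.sqrt_nonneg _),
    Real.sq_sqrt (steinEnergy_nonneg hk z)]

theorem measurable_KSD_empirical (hk : ContDiff ℝ 3 fun p : E d × E d => k p.1 p.2)
    (hV : ContDiff ℝ 3 V) (N : ℕ) : Measurable fun z : Fin N → E d => KSD k V (empirical z) := by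
  simp only [KSD_empirical hk]
  exact (Real.continuous_sqrt.comp (continuous_steinEnergy hk hV N)).measurable.ennreal_ofReal

/-! ### Flows of complete locally Lipschitz fields -/

section Flow

/-- The vector field `(z, y) ↦ (v z, g z)`, whose flow records the integrals of `g` along the
trajectories of `v`. -/
def augmentedField {F : Type*} (v : F → F) (g : F → ℝ) (p : F × ℝ) : F × ℝ := (v p.1, g p.1)

theorem locallyLipschitz_augmentedField {F : Type*} [NormedAddCommGroup F] {v : F → F}
    {g : F → ℝ} (hv : LocallyLipschitz v) (hg : LocallyLipschitz g) :
    LocallyLipschitz (augmentedField v g) := by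
  have h : LocallyLipschitz (Prod.fst : F × ℝ → F) := LipschitzWith.prod_fst.locallyLipschitz
  exact (hv.comp h).prodMk (hg.comp h)

variable {F : Type*} [NormedAddCommGroup F] [NormedSpace ℝ F] {v : F → F}

/-- On the compact unit thickening `K` of the reference trajectory the field is Lipschitz with some
constant $L$. Trajectories starting within $e^{-LT}$ of it cannot leave `K` before time $T$, and
Grönwall's inequality in `K` gives the constant $e^{LT}$. -/
theorem exists_dist_trajectories_le [FiniteDimensional ℝ F] (hv : LocallyLipschitz v) {γ₀ : ℝ → F}
    (hγ₀ : IsIntegralCurveOn γ₀ (fun _ => v) (Ici 0)) (T : ℝ) :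
    ∃ r > 0, ∃ C : NNReal, ∀ γ γ' : ℝ → F, IsIntegralCurveOn γ (fun _ => v) (Ici 0) →
      IsIntegralCurveOn γ' (fun _ => v) (Ici 0) → dist (γ 0) (γ₀ 0) < r → dist (γ' 0) (γ₀ 0) < r →
      ∀ t ∈ Icc 0 T, dist (γ t) (γ' t) ≤ C * dist (γ 0) (γ' 0) := by
  have : ProperSpace F := FiniteDimensional.proper_real F
  have hc0 : ContinuousOn γ₀ (Ici 0) := hγ₀.continuousOn
  set K := Metric.cthickening 1 (γ₀ '' Icc 0 T) with hK
  have hKc : IsCompact K :=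
    ((isCompact_Icc.image_of_continuousOn (hc0.mono Icc_subset_Ici_self))).cthickening
  obtain ⟨L, hL⟩ := (hv.locallyLipschitzOn (s := K)).exists_lipschitzOnWith_of_compact hKc
  have hmem : ∀ t ∈ Icc 0 T, ∀ y, dist y (γ₀ t) ≤ 1 → y ∈ K := fun t ht y hy =>
    Metric.mem_cthickening_of_dist_le y (γ₀ t) 1 _ (mem_image_of_mem _ ht) hy
  have hright : ∀ {γ : ℝ → F}, IsIntegralCurveOn γ (fun _ => v) (Ici 0) → ∀ t, 0 ≤ t →
      HasDerivWithinAt γ (v (γ t)) (Ici t) t := fun hγ t ht =>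
    (hγ t ht).mono (Ici_subset_Ici.2 ht)
  have hstay : ∀ γ : ℝ → F, IsIntegralCurveOn γ (fun _ => v) (Ici 0) →
      dist (γ 0) (γ₀ 0) < Real.exp (-(L * T)) → ∀ t ∈ Icc 0 T, dist (γ t) (γ₀ t) < 1 := by
    intro γ hγ hdist
    have hc : ContinuousOn γ (Ici 0) := hγ.continuousOn
    set δ := dist (γ 0) (γ₀ 0) with hδ
    have hlt : ∀ t ∈ Icc 0 T, δ * Real.exp (L * t) < 1 := by
      intro t ht
      calc δ * Real.exp (L * t) ≤ δ * Real.exp (L * T) := by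
            have := ht.2
            gcongr
        _ < Real.exp (-(L * T)) * Real.exp (L * T) := by gcongr
        _ = 1 := by rw [← Real.exp_add]; simp
    have hdc : ContinuousOn (fun t => dist (γ t) (γ₀ t)) (Ici 0) := by fun_prop
    -- Continuation argument: the times satisfying Grönwall's bound form a closed set. At such a
    -- time the distance is strictly below 1, so by continuity the trajectory remains in `K` a
    -- little longer, where Grönwall renews the bound.
    have hsub : Icc 0 T ⊆ {t | dist (γ t) (γ₀ t) ≤ δ * Real.exp (L * t)} := by
      apply IsClosed.Icc_subset_of_forall_exists_gt
      · have := isClosed_Icc.isClosed_le (hdc.mono Icc_subset_Ici_self)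
          (show ContinuousOn (fun t => δ * Real.exp (L * t)) (Icc 0 T) by fun_prop)
        convert this using 1
        ext t
        simp [and_comm]
      · simp [hδ]
      · rintro t ⟨ht, ht0, htT⟩ y hy
        have h1 : ∀ᶠ s in 𝓝[Ici 0] t, dist (γ s) (γ₀ s) < 1 :=
          (hdc t ht0).eventually_lt_const (lt_of_le_of_lt ht (hlt t ⟨ht0, htT.le⟩))
        obtain ⟨ε, hε, h2⟩ := Metric.mem_nhdsWithin_iff.1 h1
        set b := min (t + ε / 2) (min y T) with hb
        have htb : t < b := by
          simp only [hb, lt_min_iff]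
          exact ⟨by linarith, hy, htT⟩
        have hbT : b ≤ T := (min_le_right _ _).trans (min_le_right _ _)
        have hbε : b ≤ t + ε / 2 := min_le_left _ _
        have h3 : ∀ s ∈ Ico t b, dist (γ s) (γ₀ s) ≤ 1 := by
          intro s hs
          refine le_of_lt (h2 ⟨?_, ht0.trans hs.1⟩)
          rw [Metric.mem_ball, Real.dist_eq, abs_lt]
          constructor <;> linarith [hs.1, hs.2]
        have hsT : ∀ s ∈ Ico t b, s ∈ Icc 0 T := fun s hs =>
          ⟨ht0.trans hs.1, hs.2.le.trans hbT⟩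
        have h4 := dist_le_of_trajectories_ODE_of_mem (v := fun _ => v) (s := fun _ => K)
          (fun _ _ => hL) (hc.mono fun s hs => ht0.trans hs.1)
          (fun s hs => hright hγ s (ht0.trans hs.1))
          (fun s hs => hmem s (hsT s hs) _ (h3 s hs))
          (hc0.mono fun s hs => ht0.trans hs.1)
          (fun s hs => hright hγ₀ s (ht0.trans hs.1))
          (fun s hs => hmem s (hsT s hs) _ (by simp)) ht b ⟨htb.le, le_rfl⟩
        refine ⟨b, ?_, htb, (min_le_right _ _).trans (min_le_left _ _)⟩
        refine h4.trans_eq ?_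
        rw [mul_assoc, ← Real.exp_add]
        congr 2
        ring
    exact fun t ht => (hsub ht).trans_lt (hlt t ht)
  refine ⟨Real.exp (-(L * T)), Real.exp_pos _, ⟨Real.exp (L * T), (Real.exp_pos _).le⟩, ?_⟩
  intro γ γ' hγ hγ' hr hr' t ht
  have hm : ∀ s ∈ Ico 0 T, s ∈ Icc 0 T := fun s hs => Ico_subset_Icc_self hs
  have h := dist_le_of_trajectories_ODE_of_mem (v := fun _ => v) (s := fun _ => K)
    (fun _ _ => hL) (hγ.continuousOn.mono Icc_subset_Ici_self)
    (fun s hs => hright hγ s hs.1) (fun s hs => hmem s (hm s hs) _ (hstay γ hγ hr s (hm s hs)).le)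
    (hγ'.continuousOn.mono Icc_subset_Ici_self) (fun s hs => hright hγ' s hs.1)
    (fun s hs => hmem s (hm s hs) _ (hstay γ' hγ' hr' s (hm s hs)).le) le_rfl t ht
  refine h.trans ?_
  rw [mul_comm]
  refine mul_le_mul_of_nonneg_right ?_ dist_nonneg
  have := ht.2
  rw [sub_zero]
  exact Real.exp_le_exp.2 (by gcongr)

theorem eqOn_Ici_of_isIntegralCurveOn [FiniteDimensional ℝ F] (hv : LocallyLipschitz v) {γ γ' : ℝ → F}
    (hγ : IsIntegralCurveOn γ (fun _ => v) (Ici 0))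
    (hγ' : IsIntegralCurveOn γ' (fun _ => v) (Ici 0)) (h0 : γ 0 = γ' 0) :
    EqOn γ γ' (Ici 0) := by
  intro t ht
  obtain ⟨r, hr, C, h⟩ := exists_dist_trajectories_le hv hγ t
  have := h γ γ' hγ hγ' (by simpa using hr) (by simpa [h0] using hr) t ⟨ht, le_rfl⟩
  rw [h0, dist_self, mul_zero] at this
  exact dist_le_zero.1 this

theorem _root_.IsIntegralCurve.comp_neg_field {γ : ℝ → F} (hγ : IsIntegralCurve γ (fun _ => v)) :
    IsIntegralCurve (fun t => γ (-t)) (fun _ => -v) := by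
  intro t
  have h := (hγ (-t)).scomp t (hasDerivAt_neg t)
  simpa [Function.comp_def] using h

theorem _root_.LocallyLipschitz.neg_fun (hv : LocallyLipschitz v) : LocallyLipschitz (-v) := by
  have h : LocallyLipschitz (fun x : F => -x) := (contDiff_neg (𝕜 := ℝ) (n := 1)).locallyLipschitz
  exact h.comp hv

theorem eq_of_isIntegralCurve [FiniteDimensional ℝ F] (hv : LocallyLipschitz v) {γ γ' : ℝ → F}
    (hγ : IsIntegralCurve γ (fun _ => v)) (hγ' : IsIntegralCurve γ' (fun _ => v))
    (h0 : γ 0 = γ' 0) : γ = γ' := by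
  funext t
  rcases le_total 0 t with ht | ht
  · exact eqOn_Ici_of_isIntegralCurveOn hv (hγ.isIntegralCurveOn _) (hγ'.isIntegralCurveOn _) h0 ht
  · have := eqOn_Ici_of_isIntegralCurveOn hv.neg_fun (hγ.comp_neg_field.isIntegralCurveOn _)
      (hγ'.comp_neg_field.isIntegralCurveOn _) (by simpa using h0) (neg_nonneg.2 ht)
    simpa using this

/-- The flow of a complete vector field. -/
def flow (hc : IsCompleteField v) (t : ℝ) (z : F) : F := (hc z).choose t

variable (hc : IsCompleteField v)

theorem flow_zero (z : F) : flow hc 0 z = z := (hc z).choose_spec.1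

theorem isIntegralCurve_flow (z : F) : IsIntegralCurve (fun t => flow hc t z) (fun _ => v) :=
  (hc z).choose_spec.2

theorem hasDerivAt_flow (z : F) (t : ℝ) :
    HasDerivAt (fun t => flow hc t z) (v (flow hc t z)) t := isIntegralCurve_flow hc z t

theorem flow_add [FiniteDimensional ℝ F] (hv : LocallyLipschitz v) (s t : ℝ) (z : F) :
    flow hc (s + t) z = flow hc s (flow hc t z) := by
  have h := eq_of_isIntegralCurve hv (γ := fun s => flow hc (s + t) z)
    (γ' := fun s => flow hc s (flow hc t z)) (fun s => ?_) (isIntegralCurve_flow hc _)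
    (by simp [flow_zero])
  · exact congrFun h s
  · simpa using (hasDerivAt_flow hc z (s + t)).comp_add_const s t

theorem flow_neg_flow [FiniteDimensional ℝ F] (hv : LocallyLipschitz v) (t : ℝ) (z : F) :
    flow hc (-t) (flow hc t z) = z := by
  rw [← flow_add hc hv, neg_add_cancel, flow_zero]

theorem flow_flow_neg [FiniteDimensional ℝ F] (hv : LocallyLipschitz v) (t : ℝ) (z : F) :
    flow hc t (flow hc (-t) z) = z := by
  rw [← flow_add hc hv, add_neg_cancel, flow_zero]

theorem exists_dist_flow_le [FiniteDimensional ℝ F] (hv : LocallyLipschitz v) (z₀ : F) (T : ℝ) :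
    ∃ r > 0, ∃ C : NNReal, ∀ z ∈ Metric.ball z₀ r, ∀ z' ∈ Metric.ball z₀ r, ∀ t, |t| ≤ T →
      dist (flow hc t z) (flow hc t z') ≤ C * dist z z' := by
  have hI := fun z => isIntegralCurve_flow hc z
  obtain ⟨r₁, hr₁, C₁, h₁⟩ := exists_dist_trajectories_le hv ((hI z₀).isIntegralCurveOn _) T
  obtain ⟨r₂, hr₂, C₂, h₂⟩ := exists_dist_trajectories_le hv.neg_fun
    ((hI z₀).comp_neg_field.isIntegralCurveOn _) T
  refine ⟨min r₁ r₂, lt_min hr₁ hr₂, max C₁ C₂, fun z hz z' hz' t ht => ?_⟩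
  rw [Metric.mem_ball, lt_min_iff] at hz hz'
  rw [abs_le] at ht
  rcases le_total 0 t with h0 | h0
  · have := h₁ _ _ ((hI z).isIntegralCurveOn _) ((hI z').isIntegralCurveOn _)
      (by simpa [flow_zero] using hz.1) (by simpa [flow_zero] using hz'.1) t ⟨h0, ht.2⟩
    simp only [flow_zero] at this
    refine this.trans (mul_le_mul_of_nonneg_right ?_ dist_nonneg)
    exact_mod_cast le_max_left _ _
  · have := h₂ _ _ ((hI z).comp_neg_field.isIntegralCurveOn _)
      ((hI z').comp_neg_field.isIntegralCurveOn _)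
      (by simpa [flow_zero] using hz.2) (by simpa [flow_zero] using hz'.2) (-t)
      ⟨by linarith, by linarith⟩
    simp only [flow_zero, neg_neg, neg_zero] at this
    refine this.trans (mul_le_mul_of_nonneg_right ?_ dist_nonneg)
    exact_mod_cast le_max_right _ _

theorem locallyLipschitz_flow [FiniteDimensional ℝ F] (hv : LocallyLipschitz v) (t : ℝ) :
    LocallyLipschitz (flow hc t) := by
  intro z₀
  obtain ⟨r, hr, C, h⟩ := exists_dist_flow_le hc hv z₀ |t|
  exact ⟨C, _, Metric.ball_mem_nhds _ hr,
    LipschitzOnWith.of_dist_le_mul fun z hz z' hz' => h z hz z' hz' t le_rfl⟩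

theorem locallyLipschitz_uncurry_flow [FiniteDimensional ℝ F] (hv : LocallyLipschitz v) :
    LocallyLipschitz fun p : ℝ × F => flow hc p.1 p.2 := by
  -- the flow at time `t` is the flow at time `1` of the rescaled field `t • v`
  set u : F × ℝ → F × ℝ := fun p => (p.2 • v p.1, 0) with hu
  have hfst : LocallyLipschitz (Prod.fst : F × ℝ → F) := LipschitzWith.prod_fst.locallyLipschitz
  have hsnd : LocallyLipschitz (Prod.snd : F × ℝ → ℝ) := LipschitzWith.prod_snd.locallyLipschitz
  have hsmul : LocallyLipschitz fun p : ℝ × F => p.1 • p.2 :=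
    (contDiff_smul (𝕜 := ℝ) (n := 1)).locallyLipschitz
  have hul : LocallyLipschitz u :=
    (hsmul.comp (hsnd.prodMk (hv.comp hfst))).prodMk (LocallyLipschitz.const 0)
  have hcurve : ∀ p : F × ℝ, IsIntegralCurve (fun t : ℝ => (flow hc (t * p.2) p.1, p.2))
      (fun _ => u) := by
    intro p t
    have h1 : HasDerivAt (fun t : ℝ => t * p.2) p.2 t := by
      simpa using (hasDerivAt_id t).mul_const p.2
    exact ((hasDerivAt_flow hc p.1 (t * p.2)).scomp t h1).prodMk (hasDerivAt_const t p.2)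
  have huc : IsCompleteField u := fun p => ⟨_, by simp [flow_zero], hcurve p⟩
  have h1 : ∀ p : ℝ × F, flow huc 1 (p.2, p.1) = (flow hc p.1 p.2, p.1) := by
    intro p
    have h := eq_of_isIntegralCurve hul (isIntegralCurve_flow huc (p.2, p.1)) (hcurve (p.2, p.1))
      (by simp [flow_zero])
    simpa using congrFun h 1
  have h2 := (locallyLipschitz_flow huc hul 1).comp
    ((LipschitzWith.prod_snd (α := ℝ) (β := F)).locallyLipschitz.prodMk
      LipschitzWith.prod_fst.locallyLipschitz)
  convert hfst.comp h2 using 1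
  funext p
  exact (congrArg Prod.fst (h1 p)).symm

theorem continuous_flow [FiniteDimensional ℝ F] (hv : LocallyLipschitz v) :
    Continuous fun p : ℝ × F => flow hc p.1 p.2 :=
  (locallyLipschitz_uncurry_flow hc hv).continuous

/-- The flow at time `t` as a measurable automorphism. -/
def flowEquiv [FiniteDimensional ℝ F] [MeasurableSpace F] [BorelSpace F] (hv : LocallyLipschitz v) (t : ℝ) : F ≃ᵐ F where
  toFun := flow hc t
  invFun := flow hc (-t)
  left_inv := flow_neg_flow hc hv t
  right_inv := flow_flow_neg hc hv t
  measurable_toFun := (locallyLipschitz_flow hc hv t).continuous.measurable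
  measurable_invFun := (locallyLipschitz_flow hc hv (-t)).continuous.measurable

/-- The integral of a function along the trajectories of a complete vector field. -/
def flowIntegral (g : F → ℝ) (t : ℝ) (z : F) : ℝ := ∫ s in (0 : ℝ)..t, g (flow hc s z)

variable {g : F → ℝ}

theorem continuous_flow_left (z : F) : Continuous fun t => flow hc t z :=
  continuous_iff_continuousAt.2 fun t => (hasDerivAt_flow hc z t).continuousAt

theorem hasDerivAt_flowIntegral (hg : Continuous g) (z : F) (t : ℝ) :
    HasDerivAt (fun t => flowIntegral hc g t z) (g (flow hc t z)) t := by
  have h := hg.comp (continuous_flow_left hc z)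
  exact intervalIntegral.integral_hasDerivAt_right (h.intervalIntegrable _ _)
    (h.stronglyMeasurableAtFilter _ _) h.continuousAt

theorem hasDerivAt_augmented (hg : Continuous g) (z : F) (y t : ℝ) :
    HasDerivAt (fun t => (flow hc t z, y + flowIntegral hc g t z))
      (augmentedField v g (flow hc t z, y + flowIntegral hc g t z)) t :=
  (hasDerivAt_flow hc z t).prodMk ((hasDerivAt_flowIntegral hc hg z t).const_add y)

theorem isCompleteField_augmented (hc : IsCompleteField v) (hg : Continuous g) : IsCompleteField (augmentedField v g) :=
  fun p => ⟨fun t => (flow hc t p.1, p.2 + flowIntegral hc g t p.1),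
    by simp [flow_zero, flowIntegral], hasDerivAt_augmented hc hg p.1 p.2⟩

theorem flow_augmented [FiniteDimensional ℝ F] (hv : LocallyLipschitz v) (hg : LocallyLipschitz g) (t : ℝ) (z : F) (y : ℝ) :
    flow (isCompleteField_augmented hc hg.continuous) t (z, y) =
      (flow hc t z, y + flowIntegral hc g t z) := by
  have h := eq_of_isIntegralCurve (locallyLipschitz_augmentedField hv hg)
    (isIntegralCurve_flow (isCompleteField_augmented hc hg.continuous) (z, y))
    (hasDerivAt_augmented hc hg.continuous z y) (by simp [flow_zero, flowIntegral])
  exact congrFun h t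

/-- The integral is the last coordinate of the flow of the augmented field started at height 0, so
it inherits the regularity of flows. -/
theorem locallyLipschitz_uncurry_flowIntegral [FiniteDimensional ℝ F] (hv : LocallyLipschitz v)
    (hg : LocallyLipschitz g) : LocallyLipschitz fun p : ℝ × F => flowIntegral hc g p.1 p.2 := by
  have h := locallyLipschitz_uncurry_flow (isCompleteField_augmented hc hg.continuous)
    (locallyLipschitz_augmentedField hv hg)
  have h1 : LocallyLipschitz fun p : ℝ × F => (p.1, (p.2, (0 : ℝ))) :=
    LipschitzWith.prod_fst.locallyLipschitz.prodMk
      (LipschitzWith.prod_snd.locallyLipschitz.prodMk (LocallyLipschitz.const 0))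
  have h2 : LocallyLipschitz (Prod.snd : F × ℝ → ℝ) := LipschitzWith.prod_snd.locallyLipschitz
  convert h2.comp (h.comp h1) using 1
  funext p
  simp [flow_augmented hc hv hg]

theorem locallyLipschitz_flowIntegral [FiniteDimensional ℝ F] (hv : LocallyLipschitz v)
    (hg : LocallyLipschitz g) (t : ℝ) : LocallyLipschitz (flowIntegral hc g t) :=
  (locallyLipschitz_uncurry_flowIntegral hc hv hg).comp (LocallyLipschitz.prodMk_left t)

theorem flowIntegral_add [FiniteDimensional ℝ F] (hv : LocallyLipschitz v) (hg : Continuous g) (s t : ℝ) (z : F) :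
    flowIntegral hc g (t + s) z = flowIntegral hc g s z + flowIntegral hc g t (flow hc s z) := by
  have hi : ∀ a b, IntervalIntegrable (fun r => g (flow hc r z)) volume a b := fun a b =>
    (hg.comp (continuous_flow_left hc z)).intervalIntegrable a b
  simp only [flowIntegral, ← flow_add hc hv]
  rw [intervalIntegral.integral_comp_add_right (fun r => g (flow hc r z)), zero_add,
    intervalIntegral.integral_add_adjacent_intervals (hi _ _) (hi _ _)]

end Flow

/-! ### Liouville's theorem tested on Lipschitz functions -/

section Liouville

variable {F : Type*} [NormedAddCommGroup F] [NormedSpace ℝ F] [FiniteDimensional ℝ F]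

/-- On the unit thickening of the support, compactness gives a uniform constant. A point outside it
is at distance at least 1 from the support, where a bound for $|f|$ serves as Lipschitz constant. -/
theorem exists_lipschitzWith_of_hasCompactSupport {f : F → ℝ} (hf : LocallyLipschitz f)
    (hfc : HasCompactSupport f) : ∃ C, LipschitzWith C f := by
  have : ProperSpace F := FiniteDimensional.proper_real F
  have hK : IsCompact (Metric.cthickening 1 (tsupport f)) := IsCompact.cthickening hfc
  obtain ⟨C, hC⟩ := (hf.locallyLipschitzOn
    (s := Metric.cthickening 1 (tsupport f))).exists_lipschitzOnWith_of_compact hK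
  obtain ⟨M, hM⟩ := hfc.exists_bound_of_continuous hf.continuous
  have hM0 : 0 ≤ M := (norm_nonneg _).trans (hM 0)
  have key : ∀ x ∈ tsupport f, ∀ y, dist (f x) (f y) ≤ max C M.toNNReal * dist x y := by
    intro x hx y
    by_cases hy : y ∈ Metric.cthickening 1 (tsupport f)
    · refine (hC.dist_le_mul x (Metric.self_subset_cthickening _ hx) y hy).trans ?_
      exact mul_le_mul_of_nonneg_right (by exact_mod_cast le_max_left _ _) dist_nonneg
    · have hy' : f y = 0 :=
        image_eq_zero_of_notMem_tsupport fun h => hy (Metric.self_subset_cthickening _ h)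
      have h1 : 1 ≤ dist x y := by
        by_contra! h
        exact hy (Metric.mem_cthickening_of_dist_le y x 1 _ hx (by rw [dist_comm]; exact h.le))
      have h2 : dist (f x) (f y) ≤ M := by simpa [hy'] using hM x
      calc dist (f x) (f y) ≤ M * 1 := by linarith
        _ ≤ max (C : ℝ) M * dist x y := by gcongr; exact le_max_right _ _
        _ = _ := by rw [NNReal.coe_max, Real.coe_toNNReal M hM0]
  refine ⟨max C M.toNNReal, LipschitzWith.of_dist_le_mul fun x y => ?_⟩
  by_cases hx : x ∈ tsupport f
  · exact key x hx y
  by_cases hy : y ∈ tsupport f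
  · rw [dist_comm, dist_comm x]
    exact key y hy x
  · rw [image_eq_zero_of_notMem_tsupport hx, image_eq_zero_of_notMem_tsupport hy, dist_self]
    positivity

theorem _root_.LocallyLipschitz.mul_real {α : Type*} [PseudoEMetricSpace α] {f g : α → ℝ}
    (hf : LocallyLipschitz f) (hg : LocallyLipschitz g) : LocallyLipschitz fun x => f x * g x := by
  have h : LocallyLipschitz fun p : ℝ × ℝ => p.1 * p.2 :=
    (contDiff_mul (𝕜 := ℝ) (n := 1)).locallyLipschitz
  exact h.comp (hf.prodMk hg)

variable [MeasurableSpace F] [BorelSpace F] (μ : Measure F) [μ.IsAddHaarMeasure]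

/-- Multiplying `X` by a bump equal to 1 near the support of `f` makes both factors Lipschitz, one
of them with compact support, and changes neither integrand. -/
theorem integral_lineDeriv_mul_of_hasCompactSupport {C : NNReal} {f X : F → ℝ}
    (hf : LipschitzWith C f) (hfc : HasCompactSupport f) (hX : ContDiff ℝ 1 X) (e : F) :
    Integrable (fun x => lineDeriv ℝ f x e * X x) μ ∧
    ∫ x, lineDeriv ℝ f x e * X x ∂μ = -∫ x, f x * fderiv ℝ X x e ∂μ := by
  obtain ⟨R, hR⟩ := hfc.isBounded.subset_closedBall 0
  let χ : ContDiffBump (0 : F) := ⟨max R 0 + 1, max R 0 + 2, by positivity, by linarith⟩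
  have hsub : ∀ x ∈ tsupport f, x ∈ Metric.ball (0 : F) (max R 0 + 1) := fun x hx =>
    Metric.closedBall_subset_ball (by linarith [le_max_left R 0]) (hR hx)
  have hχ : ∀ x ∈ Metric.ball (0 : F) (max R 0 + 1), χ x = 1 := fun x hx =>
    χ.one_of_mem_closedBall (Metric.ball_subset_closedBall hx)
  have hgc : HasCompactSupport fun x => χ x * X x := χ.hasCompactSupport.mul_right
  have hg1 : ContDiff ℝ 1 fun x => χ x * X x := χ.contDiff.mul hX
  obtain ⟨D, hD⟩ := hg1.lipschitzWith_of_hasCompactSupport hgc one_ne_zero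
  have hlz : ∀ x, x ∉ tsupport f → lineDeriv ℝ f x e = 0 := by
    intro x hx
    have h0 : f =ᶠ[𝓝 x] fun _ => 0 := notMem_tsupport_iff_eventuallyEq.1 hx
    have h1 := (hasFDerivAt_const (𝕜 := ℝ) (0 : ℝ) x).congr_of_eventuallyEq h0
    simpa using (h1.hasLineDerivAt e).lineDeriv
  have h1 : ∀ x, lineDeriv ℝ f x e * (χ x * X x) = lineDeriv ℝ f x e * X x := by
    intro x
    by_cases hx : x ∈ tsupport f
    · rw [hχ x (hsub x hx), one_mul]
    · rw [hlz x hx, zero_mul, zero_mul]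
  have h2 : ∀ x, lineDeriv ℝ (fun x => χ x * X x) x (-e) * f x = -(f x * fderiv ℝ X x e) := by
    intro x
    by_cases hx : x ∈ tsupport f
    · have h3 : (fun x => χ x * X x) =ᶠ[𝓝 x] X := by
        filter_upwards [Metric.isOpen_ball.mem_nhds (hsub x hx)] with y hy
        rw [hχ y hy, one_mul]
      have h4 := ((hX.differentiable one_ne_zero x).hasFDerivAt).congr_of_eventuallyEq h3
      rw [(h4.hasLineDerivAt (-e)).lineDeriv, map_neg]
      ring
    · rw [image_eq_zero_of_notMem_tsupport hx]
      ring
  have h3 := hf.integral_lineDeriv_mul_eq (μ := μ) hD hgc e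
  simp only [h1, h2, integral_neg] at h3
  refine ⟨?_, h3⟩
  have h4 := (hf.locallyIntegrable_lineDeriv (μ := μ) e).integrable_smul_left_of_hasCompactSupport
    hg1.continuous hgc
  refine h4.congr (.of_forall fun x => ?_)
  simp only [smul_eq_mul]
  rw [mul_comm, h1]

variable {ι : Type*} [Fintype ι] (e : ι → F) (c : ι → F →L[ℝ] ℝ)

/-- The divergence of a vector field, with respect to a resolution `u = ∑ i, c i u • e i` of the
identity. -/
def divergenceOf (Y : F → F) (x : F) : ℝ := ∑ i, c i (fderiv ℝ Y x (e i))

variable {e c}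

theorem integral_fderiv_eq_neg_integral_divergenceOf (hec : ∀ u, ∑ i, c i u • e i = u)
    {C : NNReal} {f : F → ℝ} (hf : LipschitzWith C f) (hfc : HasCompactSupport f) {Y : F → F}
    (hY : ContDiff ℝ 1 Y) :
    Integrable (fun x => fderiv ℝ f x (Y x)) μ ∧
    ∫ x, fderiv ℝ f x (Y x) ∂μ = -∫ x, f x * divergenceOf e c Y x ∂μ := by
  have hci : ∀ i, ContDiff ℝ 1 fun x => c i (Y x) := fun i => (c i).contDiff.comp hY
  have hi := fun i => integral_lineDeriv_mul_of_hasCompactSupport μ hf hfc (hci i) (e i)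
  have hae : (fun x => ∑ i, lineDeriv ℝ f x (e i) * c i (Y x)) =ᵐ[μ]
      fun x => fderiv ℝ f x (Y x) := by
    filter_upwards [hf.ae_differentiableAt (μ := μ)] with x hx
    conv_rhs => rw [← hec (Y x), map_sum]
    refine Finset.sum_congr rfl fun i _ => ?_
    rw [map_smul, (hx.hasFDerivAt.hasLineDerivAt (e i)).lineDeriv, smul_eq_mul, mul_comm]
  refine ⟨(integrable_finsetSum _ fun i _ => (hi i).1).congr hae, ?_⟩
  rw [← integral_congr_ae hae, integral_finsetSum _ fun i _ => (hi i).1]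
  simp only [(hi _).2, divergenceOf, Finset.mul_sum]
  have hder : ∀ i x, fderiv ℝ (fun x => c i (Y x)) x (e i) = c i (fderiv ℝ Y x (e i)) := by
    intro i x
    have h := (c i).hasFDerivAt.comp x (hY.differentiable one_ne_zero x).hasFDerivAt
    rw [show (fun x => c i (Y x)) = c i ∘ Y from rfl, h.fderiv]
    rfl
  rw [integral_finsetSum, Finset.sum_neg_distrib]
  · simp only [hder]
  · intro i _
    refine Continuous.integrable_of_hasCompactSupport ?_ hfc.mul_right
    exact hf.continuous.mul ((c i).continuous.comp
      ((hY.continuous_fderiv one_ne_zero).clm_apply continuous_const))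

variable {v : F → F} (hc : IsCompleteField v) {g w : F → ℝ}

/-- The integrand has derivative $df(wv)+fwg$ at time 0, and integration by parts turns the first
term into $-f\,\nabla\cdot(wv)=-fwg$. The derivative in $s$ is needed only at $s=0$ and for almost
every $z$, so Rademacher's theorem for `f` suffices; a uniform Lipschitz bound in $s$ gives the
domination. -/
theorem hasDerivAt_integral_flow_zero (hec : ∀ u, ∑ i, c i u • e i = u)
    (hv : ContDiff ℝ 1 v) (hg : LocallyLipschitz g) (hw : ContDiff ℝ 1 w)
    (hdiv : ∀ x, divergenceOf e c (fun x => w x • v x) x = w x * g x)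
    {C : NNReal} {f : F → ℝ} (hf : LipschitzWith C f) (hfc : HasCompactSupport f) :
    HasDerivAt (fun s => ∫ z, f (flow hc s z) * Real.exp (flowIntegral hc g s z) * w z ∂μ) 0 0 := by
  have : ProperSpace F := FiniteDimensional.proper_real F
  have hv' : LocallyLipschitz v := hv.locallyLipschitz
  have hexp : LocallyLipschitz Real.exp := (Real.contDiff_exp (n := 1)).locallyLipschitz
  have hΦ : LocallyLipschitz fun p : ℝ × F =>
      f (flow hc p.1 p.2) * Real.exp (flowIntegral hc g p.1 p.2) * w p.2 :=
    ((hf.locallyLipschitz.comp (locallyLipschitz_uncurry_flow hc hv')).mul_real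
      (hexp.comp (locallyLipschitz_uncurry_flowIntegral hc hv' hg))).mul_real
        (hw.locallyLipschitz.comp LipschitzWith.prod_snd.locallyLipschitz)
  have hcont : ∀ s, Continuous fun z =>
      f (flow hc s z) * Real.exp (flowIntegral hc g s z) * w z := fun s =>
    hΦ.continuous.comp (Continuous.prodMk_right s)
  -- All points that the flow brings into the support of `f` at some time in $[-1,1]$; outside this
  -- compact set the integrand vanishes for all these times.
  set K : Set F := (fun p : ℝ × F => flow hc (-p.1) p.2) '' (Icc (-1) 1 ×ˢ tsupport f) with hK
  have hKc : IsCompact K := by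
    refine (isCompact_Icc.prod hfc).image ?_
    exact (continuous_flow hc hv').comp (by fun_prop : Continuous fun p : ℝ × F => (-p.1, p.2))
  have hout : ∀ s ∈ Icc (-1 : ℝ) 1, ∀ z ∉ K, f (flow hc s z) = 0 := by
    intro s hs z hz
    refine image_eq_zero_of_notMem_tsupport fun h => hz ?_
    exact ⟨(s, flow hc s z), ⟨hs, h⟩, flow_neg_flow hc hv' s z⟩
  obtain ⟨L, hL⟩ := (hΦ.locallyLipschitzOn
    (s := Icc (-1) 1 ×ˢ K)).exists_lipschitzOnWith_of_compact (isCompact_Icc.prod hKc)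
  have hibp := integral_fderiv_eq_neg_integral_divergenceOf μ hec hf hfc
    (Y := fun x => w x • v x) (hw.smul hv)
  have hint2 : Integrable (fun x => f x * (w x * g x)) μ :=
    Continuous.integrable_of_hasCompactSupport
      (hf.continuous.mul (hw.continuous.mul hg.continuous)) hfc.mul_right
  have hs1 : Metric.ball (0 : ℝ) 1 ⊆ Icc (-1) 1 := by
    rw [Real.ball_eq_Ioo]
    simpa using Ioo_subset_Icc_self
  have h := hasDerivAt_integral_of_dominated_loc_of_lip (μ := μ) (x₀ := (0 : ℝ))
    (F := fun s z => f (flow hc s z) * Real.exp (flowIntegral hc g s z) * w z)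
    (F' := fun z => fderiv ℝ f z (w z • v z) + f z * (w z * g z))
    (bound := K.indicator fun _ => (L : ℝ)) (s := Metric.ball 0 1)
    (Metric.ball_mem_nhds _ one_pos)
    (.of_forall fun s => (hcont s).aestronglyMeasurable) ?_
    (hibp.1.add hint2).aestronglyMeasurable ?_ ?_ ?_
  · have h3 := h.2
    rw [integral_add hibp.1 hint2, hibp.2] at h3
    simpa only [hdiv, neg_add_cancel] using h3
  · refine Continuous.integrable_of_hasCompactSupport (hcont 0) ?_
    simp only [flow_zero]
    exact hfc.mul_right.mul_right
  · refine .of_forall fun z => LipschitzOnWith.of_dist_le_mul fun s hs s' hs' => ?_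
    by_cases hz : z ∈ K
    · have := hL.dist_le_mul (s, z) ⟨hs1 hs, hz⟩ (s', z) ⟨hs1 hs', hz⟩
      simpa [Prod.dist_eq, hz] using this
    · simp only [hout _ (hs1 hs) z hz, hout _ (hs1 hs') z hz, zero_mul, dist_self]
      positivity
  · exact (integrable_indicator_iff hKc.measurableSet).2
      (integrableOn_const (hs := hKc.measure_lt_top.ne))
  · filter_upwards [hf.ae_differentiableAt (μ := μ)] with z hz
    have h0 : HasFDerivAt f (fderiv ℝ f z) (flow hc 0 z) := by
      rw [flow_zero]
      exact hz.hasFDerivAt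
    have h1 : HasDerivAt (fun s => f (flow hc s z)) (fderiv ℝ f z (v (flow hc 0 z))) 0 :=
      h0.comp_hasDerivAt (0 : ℝ) (hasDerivAt_flow hc z 0)
    have h2 := ((h1.mul (hasDerivAt_flowIntegral hc hg.continuous z 0).exp).mul_const (w z))
    refine h2.congr_deriv ?_
    simp only [flow_zero, flowIntegral, intervalIntegral.integral_same,
      Real.exp_zero, map_smul, smul_eq_mul]
    ring

/-- The group property reduces the derivative at time $t$ to the derivative at 0 for the test
function $f\circ\Phi_t\cdot e^{G_t}$, with $\Phi_t$ the flow and $G_t$ the integral of $g$ along it.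
This function is again locally Lipschitz with compact support; that class of test functions, unlike
$C^1$, is preserved here without differentiating the flow. -/
theorem integral_flow_eq (hec : ∀ u, ∑ i, c i u • e i = u)
    (hv : ContDiff ℝ 1 v) (hg : LocallyLipschitz g) (hw : ContDiff ℝ 1 w)
    (hdiv : ∀ x, divergenceOf e c (fun x => w x • v x) x = w x * g x)
    {f : F → ℝ} (hf : LocallyLipschitz f) (hfc : HasCompactSupport f) (t : ℝ) :
    ∫ z, f (flow hc t z) * Real.exp (flowIntegral hc g t z) * w z ∂μ = ∫ z, f z * w z ∂μ := by
  have hv' : LocallyLipschitz v := hv.locallyLipschitz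
  have hexp : LocallyLipschitz Real.exp := (Real.contDiff_exp (n := 1)).locallyLipschitz
  set I : ℝ → ℝ := fun t =>
    ∫ z, f (flow hc t z) * Real.exp (flowIntegral hc g t z) * w z ∂μ with hI
  have hd : ∀ t, HasDerivAt I 0 t := by
    intro t
    set f' : F → ℝ := fun z => f (flow hc t z) * Real.exp (flowIntegral hc g t z) with hf'
    have hl : LocallyLipschitz f' := (hf.comp (locallyLipschitz_flow hc hv' t)).mul_real
      (hexp.comp (locallyLipschitz_flowIntegral hc hv' hg t))
    have hcs : HasCompactSupport f' := by
      refine HasCompactSupport.intro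
        (IsCompact.image hfc (locallyLipschitz_flow hc hv' (-t)).continuous) fun z hz => ?_
      have : f (flow hc t z) = 0 := image_eq_zero_of_notMem_tsupport fun h =>
        hz ⟨_, h, flow_neg_flow hc hv' t z⟩
      simp [hf', this]
    obtain ⟨C, hC⟩ := exists_lipschitzWith_of_hasCompactSupport hl hcs
    have h := hasDerivAt_integral_flow_zero μ hc hec hv hg hw hdiv hC hcs
    have h2 := HasDerivAt.comp_sub_const t t (by rwa [sub_self])
    refine h2.congr_of_eventuallyEq (.of_forall fun r => ?_)
    refine integral_congr_ae (.of_forall fun z => ?_)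
    have h3 := flowIntegral_add hc hv' hg.continuous (r - t) t z
    have h4 := flow_add hc hv' t (r - t) z
    rw [add_sub_cancel] at h3 h4
    simp only [hf', h3, h4, Real.exp_add]
    ring
  have h := is_const_of_deriv_eq_zero (fun t => (hd t).differentiableAt) (fun t => (hd t).deriv) t 0
  simpa [hI, flow_zero, flowIntegral] using h

end Liouville

/-! ### From test functions to transport of measures -/

section MeasureTransport

variable {F : Type*} [NormedAddCommGroup F] [NormedSpace ℝ F] [FiniteDimensional ℝ F]
  [MeasurableSpace F] [BorelSpace F]

/-- Thickened indicators of a compact set are admissible test functions converging to its indicator,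
so dominated convergence identifies the measures on compact sets, exhaustion by balls on closed
sets, and a $\pi$-system argument everywhere. The domination for `m` is borrowed from `ν` through
the hypothesis. -/
theorem measure_ext_of_lintegral_lipschitz {m ν : Measure F} [IsFiniteMeasure ν]
    (h : ∀ f : F → ℝ, LocallyLipschitz f → HasCompactSupport f → (∀ x, 0 ≤ f x) →
      ∫⁻ x, ENNReal.ofReal (f x) ∂m = ∫⁻ x, ENNReal.ofReal (f x) ∂ν) : ν = m := by
  have : ProperSpace F := FiniteDimensional.proper_real F
  have hpos : ∀ n : ℕ, (0 : ℝ) < 1 / ((n : ℝ) + 1) := fun n => by positivity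
  have hcompact : ∀ C : Set F, IsCompact C → ν C = m C := by
    intro C hC
    set f : ℕ → F → NNReal := fun n => thickenedIndicator (hpos n) C with hf
    have hfl : ∀ n, LocallyLipschitz fun x => (f n x : ℝ) := fun n =>
      (LipschitzWith.of_dist_le_mul fun x y =>
        (lipschitzWith_thickenedIndicator (hpos n) C).dist_le_mul x y).locallyLipschitz
    have hfc : ∀ n, HasCompactSupport fun x => (f n x : ℝ) := fun n => by
      refine HasCompactSupport.intro (hC.cthickening (r := 1 / ((n : ℝ) + 1))) fun x hx => ?_
      have := thickenedIndicator_zero (hpos n) C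
        (fun h => hx (Metric.thickening_subset_cthickening _ _ h))
      simp only [hf, this, NNReal.coe_zero]
    have heq : ∀ n, ∫⁻ x, (f n x : ℝ≥0∞) ∂m = ∫⁻ x, (f n x : ℝ≥0∞) ∂ν := fun n => by
      simpa using h _ (hfl n) (hfc n) fun x => NNReal.coe_nonneg _
    have hle : ∀ n x, (f n x : ℝ≥0∞) ≤ f 0 x := fun n x => by
      refine ENNReal.coe_le_coe.2 (thickenedIndicator_mono (hpos n) (hpos 0) ?_ C x)
      refine one_div_le_one_div_of_le (by positivity) ?_
      simp
    have hfin : ∫⁻ x, (f 0 x : ℝ≥0∞) ∂ν ≠ ⊤ := by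
      refine ne_top_of_le_ne_top (measure_ne_top ν univ) ?_
      rw [← lintegral_one]
      exact lintegral_mono fun x => ENNReal.coe_le_coe.2 (thickenedIndicator_le_one (hpos 0) C x)
    have hmeas : ∀ n, Measurable fun x => (f n x : ℝ≥0∞) := fun n =>
      (thickenedIndicator (hpos n) C).continuous.measurable.coe_nnreal_ennreal
    have hlim : ∀ x, Tendsto (fun n => (f n x : ℝ≥0∞)) atTop (𝓝 (C.indicator 1 x)) := by
      intro x
      have h1 := tendsto_pi_nhds.1 (thickenedIndicator_tendsto_indicator_closure hpos
        tendsto_one_div_add_atTop_nhds_zero_nat C) x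
      rw [hC.isClosed.closure_eq] at h1
      convert ENNReal.tendsto_coe.2 h1 using 2
      by_cases hx : x ∈ C <;> simp [hx]
    have hI : ∀ l : Measure F, ∫⁻ x, C.indicator 1 x ∂l = l C := fun l =>
      lintegral_indicator_one hC.measurableSet
    have h1 := tendsto_lintegral_of_dominated_convergence (μ := ν) _ hmeas
      (fun n => .of_forall (hle n)) hfin (.of_forall hlim)
    have h2 := tendsto_lintegral_of_dominated_convergence (μ := m) _ hmeas
      (fun n => .of_forall (hle n)) (by rwa [heq]) (.of_forall hlim)
    rw [hI] at h1 h2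
    simp only [heq] at h2
    exact tendsto_nhds_unique h1 h2
  have hclosed : ∀ C : Set F, IsClosed C → ν C = m C := by
    intro C hC
    have hmono : Monotone fun n : ℕ => C ∩ Metric.closedBall 0 (n : ℝ) := fun a b hab =>
      inter_subset_inter_right _ (Metric.closedBall_subset_closedBall (by exact_mod_cast hab))
    have hU : ⋃ n : ℕ, C ∩ Metric.closedBall 0 (n : ℝ) = C := by
      rw [← inter_iUnion, Metric.iUnion_closedBall_nat, inter_univ]
    rw [← hU, hmono.measure_iUnion, hmono.measure_iUnion]
    refine iSup_congr fun n => hcompact _ ?_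
    exact (isCompact_closedBall _ _).inter_left hC
  refine ext_of_generate_finite _ ((BorelSpace.measurable_eq (α := F)).trans
    borel_eq_generateFrom_isClosed) isPiSystem_isClosed (fun s hs => hclosed s hs)
    (hclosed _ isClosed_univ)

variable (μ : Measure F) [μ.IsAddHaarMeasure] {ι : Type*} [Fintype ι] {e : ι → F}
  {c : ι → F →L[ℝ] ℝ} {v : F → F} (hc : IsCompleteField v) {g w : F → ℝ}

/-- The weak form of this identity is the conservation law for integrals along the flow. The
exponential weight sits on the source, so finiteness is required only of the image measure. -/
theorem map_flow_withDensity (hec : ∀ u, ∑ i, c i u • e i = u)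
    (hv : ContDiff ℝ 1 v) (hg : LocallyLipschitz g) (hw : ContDiff ℝ 1 w)
    (hdiv : ∀ x, divergenceOf e c (fun x => w x • v x) x = w x * g x)
    (hw0 : ∀ x, 0 ≤ w x) (hwi : Integrable w μ) (t : ℝ) :
    (μ.withDensity fun z => ENNReal.ofReal (Real.exp (flowIntegral hc g t z) * w z)).map
      (flow hc t) = μ.withDensity fun z => ENNReal.ofReal (w z) := by
  have hv' : LocallyLipschitz v := hv.locallyLipschitz
  have hft := (locallyLipschitz_flow hc hv' t).continuous
  have hd : Continuous fun z => Real.exp (flowIntegral hc g t z) * w z :=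
    (locallyLipschitz_flowIntegral hc hv' hg t).continuous.rexp.mul hw.continuous
  have hfin : IsFiniteMeasure (μ.withDensity fun z => ENNReal.ofReal (w z)) :=
    isFiniteMeasure_withDensity_ofReal hwi.2
  refine (measure_ext_of_lintegral_lipschitz fun f hf hfc hf0 => ?_).symm
  have hfm : Measurable fun x => ENNReal.ofReal (f x) := hf.continuous.measurable.ennreal_ofReal
  have hfm' : Measurable fun x => ENNReal.ofReal (f (flow hc t x)) := hfm.comp hft.measurable
  rw [lintegral_map hfm hft.measurable,
    lintegral_withDensity_eq_lintegral_mul _ hd.measurable.ennreal_ofReal hfm',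
    lintegral_withDensity_eq_lintegral_mul _ hw.continuous.measurable.ennreal_ofReal hfm]
  have h1 := integral_flow_eq μ hc hec hv hg hw hdiv hf hfc t
  have hi1 : Integrable (fun z => f z * w z) μ :=
    (hf.continuous.mul hw.continuous).integrable_of_hasCompactSupport hfc.mul_right
  have hi2 : Integrable (fun z => f (flow hc t z) * Real.exp (flowIntegral hc g t z) * w z) μ := by
    simp only [mul_assoc]
    refine ((hf.continuous.comp hft).mul hd).integrable_of_hasCompactSupport ?_
    refine HasCompactSupport.intro
      (IsCompact.image hfc (locallyLipschitz_flow hc hv' (-t)).continuous) fun z hz => ?_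
    have : f (flow hc t z) = 0 := image_eq_zero_of_notMem_tsupport fun h =>
      hz ⟨_, h, flow_neg_flow hc hv' t z⟩
    simp [this]
  have h2 := congrArg ENNReal.ofReal h1
  rw [ofReal_integral_eq_lintegral_ofReal hi1
      (.of_forall fun z => mul_nonneg (hf0 z) (hw0 z)),
    ofReal_integral_eq_lintegral_ofReal hi2 (.of_forall fun z =>
      mul_nonneg (mul_nonneg (hf0 _) (Real.exp_pos _).le) (hw0 z))] at h2
  convert h2 using 3 with z z
  · simp only [Pi.mul_apply]
    rw [← ENNReal.ofReal_mul (mul_nonneg (Real.exp_pos _).le (hw0 _))]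
    congr 1
    ring
  · simp only [Pi.mul_apply]
    rw [← ENNReal.ofReal_mul (hw0 _), mul_comm]

end MeasureTransport

/-! ### Relative entropy under a change of variables -/

section Entropy

variable {F : Type*} [MeasurableSpace F]

/-- This is $\mathrm{klFun}(r)=r\log r+1-r$ with the negative contributions moved across, ready to
be integrated in $[0,\infty]$. -/
theorem ofReal_klFun_add {r : ℝ} (hr : 0 ≤ r) :
    ENNReal.ofReal (klFun r) + ENNReal.ofReal r * ENNReal.ofReal (-Real.log r) +
      ENNReal.ofReal r = ENNReal.ofReal r * ENNReal.ofReal (Real.log r) + 1 := by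
  rw [← ENNReal.ofReal_mul hr, ← ENNReal.ofReal_mul hr, ← ENNReal.ofReal_one]
  have hk := klFun_nonneg hr
  rcases le_total 0 (Real.log r) with h | h
  · rw [ENNReal.ofReal_of_nonpos (mul_nonpos_of_nonneg_of_nonpos hr (neg_nonpos.2 h)), add_zero,
      ← ENNReal.ofReal_add hk hr, ← ENNReal.ofReal_add (mul_nonneg hr h) zero_le_one, klFun_apply]
    congr 1
    ring
  · have h' := neg_nonneg.2 h
    rw [ENNReal.ofReal_of_nonpos (mul_nonpos_of_nonneg_of_nonpos hr h), zero_add,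
      ← ENNReal.ofReal_add hk (mul_nonneg hr h'),
      ← ENNReal.ofReal_add (add_nonneg hk (mul_nonneg hr h')) hr, klFun_apply]
    congr 1
    ring

theorem map_withDensity_ofReal {ν : Measure F} {ρ : F → ℝ} (f : F ≃ᵐ F) {G : F → ℝ} (hG : Measurable G)
    (hinv : (ν.withDensity fun x => ENNReal.ofReal (Real.exp (G x))).map f = ν)
    (hρ : Measurable ρ) :
    (ν.withDensity fun x => ENNReal.ofReal (ρ x)).map f =
      ν.withDensity fun x => ENNReal.ofReal (ρ (f.symm x) * Real.exp (-G (f.symm x))) := by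
  have hD : Measurable fun x => ENNReal.ofReal (ρ (f.symm x) * Real.exp (-G (f.symm x))) :=
    ((hρ.comp f.symm.measurable).mul
      (hG.comp f.symm.measurable).neg.exp).ennreal_ofReal
  refine Measure.ext_of_lintegral _ fun h hh => ?_
  have hhf : Measurable fun x => h (f x) := hh.comp f.measurable
  have hDh : Measurable fun x => ((fun x => ENNReal.ofReal
      (ρ (f.symm x) * Real.exp (-G (f.symm x)))) * h) (f x) := (hD.mul hh).comp f.measurable
  rw [lintegral_map hh f.measurable, lintegral_withDensity_eq_lintegral_mul _ hρ.ennreal_ofReal hhf,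
    lintegral_withDensity_eq_lintegral_mul _ hD hh]
  conv_rhs => rw [← hinv]
  rw [lintegral_map (hD.mul hh) f.measurable, lintegral_withDensity_eq_lintegral_mul _
    hG.exp.ennreal_ofReal hDh]
  refine lintegral_congr fun x => ?_
  simp only [Pi.mul_apply, MeasurableEquiv.symm_apply_apply]
  rw [← mul_assoc, ← ENNReal.ofReal_mul (Real.exp_pos _).le, mul_left_comm, ← Real.exp_add,
    add_neg_cancel, Real.exp_zero, mul_one]

variable {ν : Measure F} [IsProbabilityMeasure ν] {ρ : F → ℝ}

/-- Both measures have mass 1, so the affine terms of `klFun` cancel and only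
$\int\rho\log\rho\,d\nu$ is left, with its negative part transposed. -/
theorem klDiv_withDensity_add (hρ : Measurable ρ) (hρ0 : ∀ x, 0 ≤ ρ x)
    [IsProbabilityMeasure (ν.withDensity fun x => ENNReal.ofReal (ρ x))] :
    klDiv (ν.withDensity fun x => ENNReal.ofReal (ρ x)) ν +
      ∫⁻ x, ENNReal.ofReal (-Real.log (ρ x)) ∂(ν.withDensity fun x => ENNReal.ofReal (ρ x)) =
      ∫⁻ x, ENNReal.ofReal (Real.log (ρ x)) ∂(ν.withDensity fun x => ENNReal.ofReal (ρ x)) := by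
  have hm := hρ.ennreal_ofReal
  have hl : Measurable fun x => Real.log (ρ x) := Real.measurable_log.comp hρ
  have hl2 : Measurable fun x => ENNReal.ofReal (-Real.log (ρ x)) := hl.neg.ennreal_ofReal
  have hkl : klDiv (ν.withDensity fun x => ENNReal.ofReal (ρ x)) ν =
      ∫⁻ x, ENNReal.ofReal (klFun (ρ x)) ∂ν := by
    rw [klDiv_eq_lintegral_klFun_of_ac (withDensity_absolutelyContinuous _ _)]
    refine lintegral_congr_ae ?_
    filter_upwards [Measure.rnDeriv_withDensity ν hm] with x hx
    rw [hx, ENNReal.toReal_ofReal (hρ0 x)]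
  have h1 : ∫⁻ x, ENNReal.ofReal (ρ x) ∂ν = 1 := by
    have := measure_univ (μ := ν.withDensity fun x => ENNReal.ofReal (ρ x))
    rwa [withDensity_apply _ MeasurableSet.univ, Measure.restrict_univ] at this
  rw [hkl, lintegral_withDensity_eq_lintegral_mul _ hm hl2,
    lintegral_withDensity_eq_lintegral_mul _ hm hl.ennreal_ofReal]
  have hp : Measurable fun x => ENNReal.ofReal (ρ x) * ENNReal.ofReal (-Real.log (ρ x)) :=
    hm.mul hl2
  have h2 := lintegral_congr (μ := ν) fun x => ofReal_klFun_add (hρ0 x)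
  rw [lintegral_add_right _ hm, lintegral_add_right _ hp,
    lintegral_add_right _ measurable_const, h1, lintegral_one, measure_univ] at h2
  exact (ENNReal.add_left_inj ENNReal.one_ne_top).1 h2

/-- From $\log r\ge1-1/r$ one gets $-r\log r\le1-r\le1$. Finiteness of this negative part is what
permits cancellation in the entropy balance. -/
theorem lintegral_ofReal_neg_log_le (hρ : Measurable ρ) (hρ0 : ∀ x, 0 ≤ ρ x) :
    ∫⁻ x, ENNReal.ofReal (-Real.log (ρ x)) ∂(ν.withDensity fun x => ENNReal.ofReal (ρ x)) ≤ 1 := by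
  have hl : Measurable fun x => Real.log (ρ x) := Real.measurable_log.comp hρ
  have hl2 : Measurable fun x => ENNReal.ofReal (-Real.log (ρ x)) := hl.neg.ennreal_ofReal
  rw [lintegral_withDensity_eq_lintegral_mul _ hρ.ennreal_ofReal hl2,
    ← measure_univ (μ := ν), ← lintegral_one]
  refine lintegral_mono fun x => ?_
  simp only [Pi.mul_apply]
  rw [← ENNReal.ofReal_mul (hρ0 x), ENNReal.ofReal_le_one]
  rcases (hρ0 x).eq_or_lt with h | h
  · rw [← h]; simp
  · have h1 := Real.one_sub_inv_le_log_of_pos h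
    have h2 := mul_le_mul_of_nonneg_left h1 h.le
    rw [mul_sub, mul_inv_cancel₀ h.ne'] at h2
    linarith

/-- The decomposition $b=b^+-b^-$ for $b=a$ and $b=a-(q+m-p)$, arranged without subtraction. -/
theorem ofReal_add_eq_of_sub {a q m p : ℝ} (hq : 0 ≤ q) (hm : 0 ≤ m) (hp : 0 ≤ p) :
    ENNReal.ofReal (a - (q + m - p)) + ENNReal.ofReal (-a) + ENNReal.ofReal q + ENNReal.ofReal m =
      ENNReal.ofReal a + ENNReal.ofReal (-(a - (q + m - p))) + ENNReal.ofReal p := by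
  have key : ∀ b : ℝ, ENNReal.ofReal b = ENNReal.ofReal (max b 0) := fun b => by
    simp [ENNReal.ofReal, Real.toNNReal]
  rw [key (a - _), key (-a), key a, key (-(a - _)), ← ENNReal.ofReal_add (by simp) (by simp),
    ← ENNReal.ofReal_add (by positivity) hq, ← ENNReal.ofReal_add (by positivity) hm,
    ← ENNReal.ofReal_add (by simp) (by simp), ← ENNReal.ofReal_add (by positivity) hp]
  congr 1
  rcases le_total 0 a with h1 | h1 <;> rcases le_total 0 (a - (q + m - p)) with h2 | h2
  · rw [max_eq_left h2, max_eq_right (by linarith), max_eq_left h1, max_eq_right (by linarith)]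
    ring
  · rw [max_eq_right h2, max_eq_right (by linarith), max_eq_left h1, max_eq_left (by linarith)]
    ring
  · rw [max_eq_left h2, max_eq_left (by linarith), max_eq_right h1, max_eq_right (by linarith)]
    ring
  · rw [max_eq_right h2, max_eq_left (by linarith), max_eq_right h1, max_eq_left (by linarith)]
    ring

/-- The entropy balance for the transport of a probability measure by an automorphism `f` whose
Jacobian with respect to the reference measure is `exp (Q + M - R)`. -/
theorem klDiv_map_add (f : F ≃ᵐ F) {Q M R : F → ℝ} (hQ : Measurable Q) (hM : Measurable M)
    (hR : Measurable R) (hQ0 : ∀ x, 0 ≤ Q x) (hM0 : ∀ x, 0 ≤ M x) (hR0 : ∀ x, 0 ≤ R x)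
    (hinv : (ν.withDensity fun x => ENNReal.ofReal (Real.exp (Q x + M x - R x))).map f = ν)
    (hρ : Measurable ρ) (hρ0 : ∀ x, 0 ≤ ρ x) {μ : Measure F} [IsProbabilityMeasure μ]
    (hμ : μ = ν.withDensity fun x => ENNReal.ofReal (ρ x)) :
    klDiv (μ.map f) ν + ∫⁻ x, ENNReal.ofReal (Q x) ∂μ + ∫⁻ x, ENNReal.ofReal (M x) ∂μ =
      klDiv μ ν + ∫⁻ x, ENNReal.ofReal (R x) ∂μ := by
  have hG : Measurable fun x => Q x + M x - R x := (hQ.add hM).sub hR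
  obtain ⟨ρ', hρ'⟩ : ∃ ρ' : F → ℝ, ∀ x, ρ' x = ρ (f.symm x) *
    Real.exp (-(Q (f.symm x) + M (f.symm x) - R (f.symm x))) := ⟨_, fun _ => rfl⟩
  have hρ'm : Measurable ρ' := by
    rw [funext hρ']
    exact (hρ.comp f.symm.measurable).mul (hG.comp f.symm.measurable).neg.exp
  have hρ'0 : ∀ x, 0 ≤ ρ' x := fun x => by
    rw [hρ']
    exact mul_nonneg (hρ0 _) (Real.exp_pos _).le
  have hmap : μ.map f = ν.withDensity fun x => ENNReal.ofReal (ρ' x) := by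
    simp only [hμ, hρ']
    have h := map_withDensity_ofReal f (G := fun x => Q x + M x - R x) hG hinv hρ
    exact h
  have hpm : IsProbabilityMeasure (μ.map f) :=
    Measure.isProbabilityMeasure_map f.measurable.aemeasurable
  have hl : Measurable fun x => Real.log (ρ x) := Real.measurable_log.comp hρ
  have hl2 : Measurable fun x => ENNReal.ofReal (-Real.log (ρ x)) := hl.neg.ennreal_ofReal
  have hl' : Measurable fun x => Real.log (ρ' x) := Real.measurable_log.comp hρ'm
  have hl2' : Measurable fun x => ENNReal.ofReal (-Real.log (ρ' x)) := hl'.neg.ennreal_ofReal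
  -- The density `ρ` is positive almost everywhere for `μ`, though not for `ν`; hence the logarithm
  -- of the product splits.
  have hpos : ∀ᵐ x ∂μ, Real.log (ρ' (f x)) = Real.log (ρ x) - (Q x + M x - R x) := by
    rw [hμ, ae_withDensity_iff hρ.ennreal_ofReal]
    refine .of_forall fun x hx => ?_
    have h1 : 0 < ρ x := by simpa using hx
    simp only [hρ', MeasurableEquiv.symm_apply_apply]
    rw [Real.log_mul h1.ne' (Real.exp_pos _).ne', Real.log_exp]
    ring
  have e1 : klDiv μ ν + ∫⁻ x, ENNReal.ofReal (-Real.log (ρ x)) ∂μ =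
      ∫⁻ x, ENNReal.ofReal (Real.log (ρ x)) ∂μ := by
    subst hμ
    exact klDiv_withDensity_add hρ hρ0
  have f1 : ∫⁻ x, ENNReal.ofReal (-Real.log (ρ x)) ∂μ ≤ 1 := by
    rw [hμ]
    exact lintegral_ofReal_neg_log_le hρ hρ0
  have e2 : klDiv (μ.map f) ν +
      ∫⁻ x, ENNReal.ofReal (-(Real.log (ρ x) - (Q x + M x - R x))) ∂μ =
      ∫⁻ x, ENNReal.ofReal (Real.log (ρ x) - (Q x + M x - R x)) ∂μ := by
    have h : klDiv (μ.map f) ν + ∫⁻ x, ENNReal.ofReal (-Real.log (ρ' x)) ∂(μ.map f) =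
        ∫⁻ x, ENNReal.ofReal (Real.log (ρ' x)) ∂(μ.map f) := by
      rw [hmap] at hpm ⊢
      exact klDiv_withDensity_add hρ'm hρ'0
    rw [lintegral_map hl2' f.measurable,
      lintegral_map hl'.ennreal_ofReal f.measurable] at h
    convert h using 1
    · congr 1
      exact lintegral_congr_ae (hpos.mono fun x hx => by simp only [hx])
    · exact lintegral_congr_ae (hpos.mono fun x hx => by simp only [hx])
  have f2 : ∫⁻ x, ENNReal.ofReal (-(Real.log (ρ x) - (Q x + M x - R x))) ∂μ ≤ 1 := by
    have h := lintegral_ofReal_neg_log_le (ν := ν) hρ'm hρ'0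
    rw [← hmap, lintegral_map hl2' f.measurable] at h
    refine le_trans (le_of_eq ?_) h
    exact lintegral_congr_ae (hpos.mono fun x hx => by simp only [hx])
  have h3 := lintegral_congr (μ := μ) fun x =>
    ofReal_add_eq_of_sub (a := Real.log (ρ x)) (hQ0 x) (hM0 x) (hR0 x)
  rw [lintegral_add_right _ hM.ennreal_ofReal, lintegral_add_right _ hQ.ennreal_ofReal,
    lintegral_add_right _ hl2, lintegral_add_right _ hR.ennreal_ofReal,
    lintegral_add_left hl.ennreal_ofReal, ← e1, ← e2] at h3
  have g1 := ne_top_of_le_ne_top ENNReal.one_ne_top f1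
  have g2 := ne_top_of_le_ne_top ENNReal.one_ne_top f2
  -- The negative parts of the initial and final log-densities have integral at most 1, so both can
  -- be cancelled even if the entropies are infinite.
  rw [← ENNReal.add_left_inj (ENNReal.add_ne_top.2 ⟨g1, g2⟩)]
  convert h3 using 1 <;> ring

end Entropy

/-! ### The divergence of the SVGD field relative to the product target -/

section Divergence

variable {d : ℕ}

theorem divergence_gradient {f : E d → ℝ} (hf : ContDiff ℝ 2 f) (x : E d) :
    divergence (gradient f) x = Δ f x := by
  have h1 : Differentiable ℝ (gradient f) :=
    (contDiff_gradient (n := 1) (by exact_mod_cast hf)).differentiable one_ne_zero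
  have h2 : Differentiable ℝ (fderiv ℝ f) :=
    (hf.fderiv_right (m := 1) (by norm_num)).differentiable one_ne_zero
  rw [InnerProductSpace.laplacian_eq_iteratedFDeriv_orthonormalBasis f
    (EuclideanSpace.basisFun (Fin d) ℝ)]
  refine Finset.sum_congr rfl fun a _ => ?_
  rw [iteratedFDeriv_two_apply]
  have e1 := (EuclideanSpace.proj (𝕜 := ℝ) a).hasFDerivAt.comp x (h1 x).hasFDerivAt
  have e2 := (h2 x).hasFDerivAt.clm_apply
    (hasFDerivAt_const (EuclideanSpace.single a (1 : ℝ) : E d) x)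
  have e3 : (EuclideanSpace.proj (𝕜 := ℝ) a : E d → ℝ) ∘ gradient f =
      fun y => fderiv ℝ f y (EuclideanSpace.single a 1) := by
    funext y
    exact gradient_apply y a
  rw [e3] at e1
  have e4 := congrArg (fun L : E d →L[ℝ] ℝ => L (EuclideanSpace.single a 1)) (e1.unique e2)
  simpa using e4

/-- The product rule in the second slot. This is the source of $C^*$: the effect of a particle's
interaction with itself. -/
theorem divergence_interaction_diag {k : PDKernel (E d)} {V : E d → ℝ}
    (hk : ContDiff ℝ 3 fun p : E d × E d => k p.1 p.2) (hV : ContDiff ℝ 3 V) (x : E d) :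
    divergence (interaction k V x) x = -Cstar k V x := by
  have hkx : ContDiff ℝ 3 (k x) := hk.comp (contDiff_prodMk_right x)
  have h1 : HasFDerivAt (k x) (fderiv ℝ (k x) x) x :=
    (hkx.differentiable (by norm_num) x).hasFDerivAt
  have h2 : HasFDerivAt (gradient V) (fderiv ℝ (gradient V) x) x :=
    ((contDiff_gradient (n := 2) (by exact_mod_cast hV)).differentiable (by norm_num) x).hasFDerivAt
  have h3 : HasFDerivAt (gradient (k x)) (fderiv ℝ (gradient (k x)) x) x :=
    ((contDiff_gradient (n := 2) (by exact_mod_cast hkx)).differentiable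
      (by norm_num) x).hasFDerivAt
  have h4 : HasFDerivAt (interaction k V x) _ x := ((h1.smul h2).neg).add h3
  rw [Cstar, ← divergence_gradient (hV.of_le (by norm_num)),
    ← divergence_gradient (hkx.of_le (by norm_num))]
  simp only [divergence, h4.fderiv, PiLp.inner_apply, gradient_apply, Finset.mul_sum]
  rw [← Finset.sum_add_distrib, ← Finset.sum_sub_distrib, ← Finset.sum_neg_distrib]
  refine Finset.sum_congr rfl fun a _ => ?_
  simp [gradient_apply]
  ring

theorem continuous_Cstar {k : PDKernel (E d)} {V : E d → ℝ}
    (hk : ContDiff ℝ 3 fun p : E d × E d => k p.1 p.2) (hV : ContDiff ℝ 3 V) :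
    Continuous (Cstar k V) := by
  have hA := contDiff_interaction hk hV
  have h1 : ContDiff ℝ 1 fun x : E d => fderiv ℝ (interaction k V x) x :=
    ContDiff.fderiv (m := 2) (n := 1) (f := fun x : E d => interaction k V x) hA
      (contDiff_id (𝕜 := ℝ)) le_rfl
  have h2 : Continuous fun x : E d => divergence (interaction k V x) x :=
    continuous_finsetSum _ fun a _ => (EuclideanSpace.proj (𝕜 := ℝ) a).continuous.comp
      (h1.continuous.clm_apply continuous_const)
  simp only [divergence_interaction_diag hk hV] at h2
  exact h2.neg.congr fun x => neg_neg _

/-- The standard basis vectors of `(ℝ^d)^N`. -/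
def configBasis (N d : ℕ) (p : Fin N × Fin d) : Fin N → E d :=
  Pi.single p.1 (EuclideanSpace.single p.2 1)

/-- The standard coordinates of `(ℝ^d)^N`. -/
def configCoord (N d : ℕ) (p : Fin N × Fin d) : (Fin N → E d) →L[ℝ] ℝ :=
  (EuclideanSpace.proj p.2).comp (ContinuousLinearMap.proj p.1)

theorem configCoord_apply {N : ℕ} (p : Fin N × Fin d) (u : Fin N → E d) :
    configCoord N d p u = u p.1 p.2 := rfl

theorem sum_configCoord_smul_configBasis {N : ℕ} (u : Fin N → E d) :
    ∑ p, configCoord N d p u • configBasis N d p = u := by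
  rw [Fintype.sum_prod_type]
  ext i a
  simp only [configCoord_apply, configBasis, Finset.sum_apply, WithLp.ofLp_sum, Pi.smul_apply,
    PiLp.smul_apply, smul_eq_mul]
  rw [Finset.sum_eq_single i, Finset.sum_eq_single a]
  · simp
  · intro b _ hb
    simp [hb.symm]
  · simp
  · intro j _ hj
    simp [hj.symm]
  · simp

/-- The derivative of the density of the `N`-fold product of the target, relative to the density
itself. -/
theorem divergenceOf_density_smul_svgdField {k : PDKernel (E d)} {V : E d → ℝ}
    (hk : ContDiff ℝ 3 fun p : E d × E d => k p.1 p.2) (hV : ContDiff ℝ 3 V) {N : ℕ} (hN : 1 ≤ N)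
    (c : ℝ) (z : Fin N → E d) :
    divergenceOf (configBasis N d) (configCoord N d)
      (fun z => (c * Real.exp (-∑ i, V (z i))) • svgdField k V N z) z =
    (c * Real.exp (-∑ i, V (z i))) *
      (N * steinEnergy k V z - 1 / (N : ℝ) * ∑ i, Cstar k V (z i)) := by
  have hN0 : (N : ℝ) ≠ 0 := by positivity
  have hA := contDiff_interaction hk hV
  set A' : E d → E d → (E d × E d →L[ℝ] E d) := fun x y =>
    fderiv ℝ (fun p : E d × E d => interaction k V p.1 p.2) (x, y) with hA'
  have hAd : ∀ x y, HasFDerivAt (fun p : E d × E d => interaction k V p.1 p.2) (A' x y) (x, y) :=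
    fun x y => (hA.differentiable (by norm_num) (x, y)).hasFDerivAt
  have hleft : ∀ x y u, fderiv ℝ (fun x => interaction k V x y) x u = A' x y (u, 0) := by
    intro x y u
    have h : HasFDerivAt (fun x => interaction k V x y)
        ((A' x y).comp (ContinuousLinearMap.inl ℝ (E d) (E d))) x :=
      HasFDerivAt.comp (g := fun p : E d × E d => interaction k V p.1 p.2)
        (f := fun x => (x, y)) x (hAd x y) (hasFDerivAt_prodMk_left x y)
    rw [h.fderiv]
    simp
  have hright : ∀ x y u, fderiv ℝ (interaction k V x) y u = A' x y (0, u) := by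
    intro x y u
    have h : HasFDerivAt (interaction k V x) _ y :=
      HasFDerivAt.comp (g := fun p : E d × E d => interaction k V p.1 p.2) y (hAd x y) (hasFDerivAt_prodMk_right x y)
    rw [h.fderiv]
    simp
  -- derivative of the driving field
  have hv : HasFDerivAt (svgdField k V N) (fderiv ℝ (svgdField k V N) z) z :=
    ((contDiff_svgdField hk hV N).differentiable (by norm_num) z).hasFDerivAt
  -- Moving particle $i$ varies the first slot of every term in its own velocity, but the second
  -- slot only of the term $j=i$.
  have hvc : ∀ p, configCoord N d p (fderiv ℝ (svgdField k V N) z (configBasis N d p)) =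
      1 / (N : ℝ) * (∑ j, A' (z p.1) (z j) (EuclideanSpace.single p.2 1, 0) p.2 +
        A' (z p.1) (z p.1) (0, EuclideanSpace.single p.2 1) p.2) := by
    rintro ⟨i, a⟩
    have h1 : HasFDerivAt (fun z => svgdField k V N z i) ((1 / (N : ℝ)) • ∑ j,
        (A' (z i) (z j)).comp ((ContinuousLinearMap.proj i).prod (ContinuousLinearMap.proj j))) z := by
      simp only [svgdField_apply]
      refine HasFDerivAt.fun_const_smul (HasFDerivAt.fun_sum fun j _ => ?_) _
      exact (hAd (z i) (z j)).comp z (((ContinuousLinearMap.proj (R := ℝ)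
        (φ := fun _ : Fin N => E d) i).prod (ContinuousLinearMap.proj j)).hasFDerivAt)
    have h2 := (ContinuousLinearMap.proj (R := ℝ) (φ := fun _ : Fin N => E d) i).hasFDerivAt.comp z hv
    have h3 := congrArg (fun L => L (configBasis N d (i, a)) a) (h2.unique h1)
    have h4 : ∀ j, A' (z i) (z j) (EuclideanSpace.single a 1,
        (Pi.single i (EuclideanSpace.single a 1) : Fin N → E d) j) a =
        A' (z i) (z j) (EuclideanSpace.single a 1, 0) a +
        if i = j then A' (z i) (z i) (0, EuclideanSpace.single a 1) a else 0 := by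
      intro j
      split_ifs with hij
      · subst hij
        rw [Pi.single_eq_same, ← PiLp.add_apply, ← map_add, Prod.mk_add_mk, add_zero, zero_add]
      · rw [Pi.single_eq_of_ne (Ne.symm hij), add_zero]
    simp only [ContinuousLinearMap.comp_apply, ContinuousLinearMap.proj_apply, FunLike.coe_smul,
      Pi.smul_apply, FunLike.coe_sum, Finset.sum_apply, ContinuousLinearMap.prod_apply,
      PiLp.smul_apply, WithLp.ofLp_sum, smul_eq_mul, configBasis, Pi.single_eq_same, h4,
      Finset.sum_add_distrib, Finset.sum_ite_eq, Finset.mem_univ, if_true] at h3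
    simpa only [configCoord_apply, configBasis] using h3
  -- derivative of the density
  set w : (Fin N → E d) → ℝ := fun z => c * Real.exp (-∑ i, V (z i)) with hw
  have hwd : HasFDerivAt w (c • (Real.exp (-∑ i, V (z i)) • -∑ i,
      (fderiv ℝ V (z i)).comp (ContinuousLinearMap.proj i))) z := by
    refine ((HasFDerivAt.fun_sum fun i _ => ?_).fun_neg.exp).const_mul c
    exact (hV.differentiable (by norm_num) (z i)).hasFDerivAt.comp z
      (ContinuousLinearMap.proj (R := ℝ) (φ := fun _ : Fin N => E d) i).hasFDerivAt
  have hwe : ∀ p, fderiv ℝ w z (configBasis N d p) = -(w z * gradient V (z p.1) p.2) := by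
    rintro ⟨i, a⟩
    have h5 : ∀ j, fderiv ℝ V (z j) ((Pi.single i (EuclideanSpace.single a 1) : Fin N → E d) j) =
        if i = j then gradient V (z i) a else 0 := by
      intro j
      split_ifs with hij
      · subst hij
        rw [Pi.single_eq_same, gradient_apply]
      · rw [Pi.single_eq_of_ne (Ne.symm hij), map_zero]
    rw [hwd.fderiv]
    simp [configBasis, h5, hw]
    ring
  have hprod : ∀ p, configCoord N d p (fderiv ℝ (fun z => w z • svgdField k V N z) z
      (configBasis N d p)) = w z * (configCoord N d p (fderiv ℝ (svgdField k V N) z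
        (configBasis N d p)) - gradient V (z p.1) p.2 * svgdField k V N z p.1 p.2) := by
    intro p
    have h6 : HasFDerivAt (fun z => w z • svgdField k V N z) _ z :=
      (hwd.differentiableAt.hasFDerivAt).smul hv
    rw [h6.fderiv]
    simp only [FunLike.coe_add, Pi.add_apply, FunLike.coe_smul, Pi.smul_apply, map_add, map_smul,
      ContinuousLinearMap.smulRight_apply, hwe, smul_eq_mul]
    simp only [configCoord_apply]
    ring
  change divergenceOf _ _ (fun z => w z • svgdField k V N z) z = w z * _
  simp only [divergenceOf, hprod, ← Finset.mul_sum]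
  congr 1
  rw [Fintype.sum_prod_type]
  simp only [hvc]
  -- The first-slot divergence together with $-\nabla V(z_i)\cdot v_i$, which comes from the
  -- density, is the Stein operator acting on the first slot: the row sum of the Stein kernel.
  have hrow : ∀ i, ∑ a, (1 / (N : ℝ) * (∑ j, A' (z i) (z j) (EuclideanSpace.single a 1, 0) a +
        A' (z i) (z i) (0, EuclideanSpace.single a 1) a) -
        gradient V (z i) a * svgdField k V N z i a) =
      1 / (N : ℝ) * ∑ j, steinKernel k V (z i) (z j) - 1 / (N : ℝ) * Cstar k V (z i) := by
    intro i
    have h7 : ∑ a, A' (z i) (z i) (0, EuclideanSpace.single a 1) a = -Cstar k V (z i) := by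
      rw [← divergence_interaction_diag hk hV]
      simp only [divergence, hright]
    have h8 : ∀ j, steinKernel k V (z i) (z j) =
        -⟪gradient V (z i), interaction k V (z i) (z j)⟫ +
          ∑ a, A' (z i) (z j) (EuclideanSpace.single a 1, 0) a := by
      intro j
      simp only [steinKernel, steinOp, divergence, hleft]
    have h9 : ∑ a, gradient V (z i) a * svgdField k V N z i a =
        1 / (N : ℝ) * ∑ j, ⟪gradient V (z i), interaction k V (z i) (z j)⟫ := by
      rw [← inner_sum, ← real_inner_smul_right, ← svgdField_apply, PiLp.inner_apply]
      simp [mul_comm]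
    rw [Finset.sum_sub_distrib, h9, ← Finset.mul_sum, Finset.sum_add_distrib, h7, Finset.sum_comm]
    simp only [h8, Finset.sum_add_distrib, Finset.sum_neg_distrib]
    ring
  simp only [hrow, Finset.sum_sub_distrib, ← Finset.mul_sum, steinEnergy]
  field_simp

end Divergence

/-! ### The entropy balance of the particle system -/

section Balance

theorem pi_withDensity_ofReal {ι X : Type*} [Fintype ι] [MeasureSpace X]
    [SigmaFinite (volume : Measure X)] {f : X → ℝ} (hf : Integrable f) (hf0 : ∀ x, 0 ≤ f x) :
    Measure.pi (fun _ : ι => (volume : Measure X).withDensity fun x => ENNReal.ofReal (f x)) =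
      volume.withDensity fun z : ι → X => ENNReal.ofReal (∏ i, f (z i)) := by
  have hfin : IsFiniteMeasure ((volume : Measure X).withDensity fun x => ENNReal.ofReal (f x)) :=
    isFiniteMeasure_withDensity_ofReal hf.2
  refine Measure.pi_eq fun s hs => ?_
  have h1 : ((volume : Measure (ι → X)).restrict (univ.pi s)) =
      Measure.pi fun i => (volume : Measure X).restrict (s i) := by
    rw [volume_pi, Measure.restrict_pi_pi]
  rw [withDensity_apply _ (MeasurableSet.univ_pi hs), h1, ← ofReal_integral_eq_lintegral_ofReal
    (Integrable.fintype_prod fun i => hf.integrableOn)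
    (.of_forall fun z => Finset.prod_nonneg fun i _ => hf0 _),
    integral_fintype_prod_eq_prod (fun _ => f),
    ENNReal.ofReal_prod_of_nonneg fun i _ => integral_nonneg hf0]
  refine Finset.prod_congr rfl fun i _ => ?_
  rw [withDensity_apply _ (hs i), ofReal_integral_eq_lintegral_ofReal hf.integrableOn
    (.of_forall hf0)]

variable {d : ℕ} {k : PDKernel (E d)} {V : E d → ℝ}

theorem integral_exp_neg_pos (hπ : Integrable (fun y => Real.exp (-V y)) volume) :
    0 < ∫ y, Real.exp (-V y) := integral_exp_pos hπ

theorem pi_target (hπ : Integrable (fun y => Real.exp (-V y)) volume) (N : ℕ) :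
    Measure.pi (fun _ : Fin N => target V) = volume.withDensity fun z : Fin N → E d =>
      ENNReal.ofReal (((∫ y, Real.exp (-V y)) ^ N)⁻¹ * Real.exp (-∑ i, V (z i))) := by
  have h := pi_withDensity_ofReal (ι := Fin N) (hπ.div_const (∫ y, Real.exp (-V y)))
    fun y => div_nonneg (Real.exp_pos _).le (integral_exp_neg_pos hπ).le
  simp only [target, Measure.tilted]
  rw [h]
  congr 1
  funext z
  rw [Finset.prod_div_distrib, ← Real.exp_sum, Finset.sum_neg_distrib]
  simp [div_eq_inv_mul]

theorem isProbabilityMeasure_target (hπ : Integrable (fun y => Real.exp (-V y)) volume) :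
    IsProbabilityMeasure (target V) := isProbabilityMeasure_tilted hπ

variable {N : ℕ} {Ω : Type*} [MeasurableSpace Ω] {P : Measure Ω}
  {x : ℝ → Ω → Fin N → E d}

theorem locallyLipschitz_svgdField (hk : ContDiff ℝ 3 fun p : E d × E d => k p.1 p.2)
    (hV : ContDiff ℝ 3 V) (N : ℕ) : LocallyLipschitz (svgdField k V N) :=
  ((contDiff_svgdField hk hV N).of_le (by norm_num)).locallyLipschitz (𝕂 := ℝ)

theorem IsSVGD.ae_eq_flow (hk : ContDiff ℝ 3 fun p : E d × E d => k p.1 p.2)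
    (hV : ContDiff ℝ 3 V) (h : IsSVGD k V N P x) :
    ∀ᵐ ω ∂P, ∀ t, 0 ≤ t → x t ω = flow h.complete t (x 0 ω) := by
  filter_upwards [h.solution] with ω hω t ht
  exact eqOn_Ici_of_isIntegralCurveOn (locallyLipschitz_svgdField hk hV N) hω
    ((isIntegralCurve_flow h.complete (x 0 ω)).isIntegralCurveOn _) (by simp [flow_zero]) ht

theorem IsSVGD.map_eq (hk : ContDiff ℝ 3 fun p : E d × E d => k p.1 p.2)
    (hV : ContDiff ℝ 3 V) (h : IsSVGD k V N P x) {t : ℝ} (ht : 0 ≤ t) :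
    P.map (x t) = (P.map (x 0)).map (flow h.complete t) := by
  have hm : Measurable (flow h.complete t) :=
    (locallyLipschitz_flow h.complete (locallyLipschitz_svgdField hk hV N) t).continuous.measurable
  rw [AEMeasurable.map_map_of_aemeasurable hm.aemeasurable h.aemeasurable_init]
  exact Measure.map_congr ((h.ae_eq_flow hk hV).mono fun ω hω => hω t ht)

/-- Joint measurability of the process in $(t,\omega)$ is not assumed. Replacing paths by the flow
from the initial configuration supplies it, and Tonelli's theorem applies. -/
theorem IsSVGD.lintegral_time [IsProbabilityMeasure P]
    (hk : ContDiff ℝ 3 fun p : E d × E d => k p.1 p.2)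
    (hV : ContDiff ℝ 3 V) (h : IsSVGD k V N P x) {f : (Fin N → E d) → ℝ≥0∞} (hf : Measurable f)
    (T : ℝ) :
    ∫⁻ t in Icc 0 T, ∫⁻ ω, f (x t ω) ∂P =
      ∫⁻ z, (∫⁻ t in Icc 0 T, f (flow h.complete t z)) ∂(P.map (x 0)) := by
  have hv := locallyLipschitz_svgdField hk hV N
  have hm : ∀ t, Measurable fun z => f (flow h.complete t z) := fun t =>
    hf.comp (locallyLipschitz_flow h.complete hv t).continuous.measurable
  have h1 : ∀ t ∈ Icc 0 T, ∫⁻ ω, f (x t ω) ∂P =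
      ∫⁻ z, f (flow h.complete t z) ∂(P.map (x 0)) := by
    intro t ht
    rw [lintegral_map' (hm t).aemeasurable h.aemeasurable_init]
    exact lintegral_congr_ae ((h.ae_eq_flow hk hV).mono fun ω hω => by
      simp only [hω t ht.1])
  have : IsProbabilityMeasure (P.map (x 0)) := Measure.isProbabilityMeasure_map h.aemeasurable_init
  rw [setLIntegral_congr_fun measurableSet_Icc h1, lintegral_lintegral_swap]
  exact (hf.comp (continuous_flow h.complete hv).measurable).aemeasurable

theorem IsSVGD.lintegral_flowIntegral [IsProbabilityMeasure P]
    (hk : ContDiff ℝ 3 fun p : E d × E d => k p.1 p.2)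
    (hV : ContDiff ℝ 3 V) (h : IsSVGD k V N P x) {q : (Fin N → E d) → ℝ} (hq : Continuous q)
    (hq0 : ∀ z, 0 ≤ q z) {T : ℝ} (hT : 0 ≤ T) :
    ∫⁻ z, ENNReal.ofReal (flowIntegral h.complete q T z) ∂(P.map (x 0)) =
      ∫⁻ t in Icc 0 T, ∫⁻ ω, ENNReal.ofReal (q (x t ω)) ∂P := by
  rw [h.lintegral_time hk hV hq.measurable.ennreal_ofReal]
  refine lintegral_congr fun z => ?_
  have hc : Continuous fun t => q (flow h.complete t z) :=
    hq.comp (continuous_flow_left h.complete z)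
  rw [flowIntegral, intervalIntegral.integral_of_le hT, ofReal_integral_eq_lintegral_ofReal
    (hc.integrableOn_Icc.mono_set Ioc_subset_Icc_self) (.of_forall fun t => hq0 _),
    Measure.restrict_congr_set Ioc_ae_eq_Icc]

/-- The entropy balance of the particle system. -/
theorem IsSVGD.entropy_balance [IsProbabilityMeasure P]
    (hk : ContDiff ℝ 3 fun p : E d × E d => k p.1 p.2)
    (hV : ContDiff ℝ 3 V) (hπ : Integrable (fun y => Real.exp (-V y)) volume) (hN : 1 ≤ N)
    (h : IsSVGD k V N P x) {T : ℝ} (hT : 0 ≤ T) :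
    entropy V P x T + N * ksdSqIntegral k V P x T +
        (N : ℝ≥0∞)⁻¹ * posIntegral P T (fun t ω => -CstarSum k V x t ω) =
      entropy V P x 0 + (N : ℝ≥0∞)⁻¹ * posIntegral P T (CstarSum k V x) := by
  have hv := locallyLipschitz_svgdField hk hV N
  have hv1 : ContDiff ℝ 1 (svgdField k V N) := (contDiff_svgdField hk hV N).of_le (by norm_num)
  have hNpos : (0 : ℝ) < N := by exact_mod_cast hN
  have hπ' := isProbabilityMeasure_target hπ
  have hP0 : IsProbabilityMeasure (P.map (x 0)) :=
    Measure.isProbabilityMeasure_map h.aemeasurable_init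
  set c : ℝ := ((∫ y, Real.exp (-V y)) ^ N)⁻¹ with hc
  have hc0 : 0 < c := inv_pos.2 (pow_pos (integral_exp_neg_pos hπ) N)
  obtain ⟨w, hw⟩ : ∃ w : (Fin N → E d) → ℝ, w = fun z => c * Real.exp (-∑ i, V (z i)) := ⟨_, rfl⟩
  have hwpos : ∀ z, 0 < w z := fun z => by rw [hw]; exact mul_pos hc0 (Real.exp_pos _)
  have hVs : ContDiff ℝ 3 fun z : Fin N → E d => ∑ i, V (z i) :=
    ContDiff.sum fun i _ => hV.comp (contDiff_apply ℝ (E d) i)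
  have hw3 : ContDiff ℝ 3 w := by
    rw [hw]
    exact contDiff_const.mul hVs.neg.exp
  have hpi : Measure.pi (fun _ : Fin N => target V) =
      volume.withDensity fun z => ENNReal.ofReal (w z) := by rw [pi_target hπ, hw]
  have hwi : Integrable w := by
    refine ⟨hw3.continuous.aestronglyMeasurable, ?_⟩
    rw [hasFiniteIntegral_iff_ofReal (.of_forall fun z => (hwpos z).le)]
    have h1 := measure_univ (μ := Measure.pi fun _ : Fin N => target V)
    rw [hpi, withDensity_apply _ MeasurableSet.univ, Measure.restrict_univ] at h1
    rw [h1]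
    exact ENNReal.one_lt_top
  -- the divergence of the field relative to the target
  set S : (Fin N → E d) → ℝ := fun z => ∑ i, Cstar k V (z i) with hS
  have hSc : Continuous S :=
    continuous_finsetSum _ fun i _ => (continuous_Cstar hk hV).comp (continuous_apply i)
  have hEc : Continuous fun z : Fin N → E d => steinEnergy k V z := continuous_steinEnergy hk hV N
  set g : (Fin N → E d) → ℝ := fun z => N * steinEnergy k V z - 1 / (N : ℝ) * S z with hg
  have hdiv : ∀ z, divergenceOf (configBasis N d) (configCoord N d)
      (fun z => w z • svgdField k V N z) z = w z * g z := fun z => by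
    rw [hw]
    exact divergenceOf_density_smul_svgdField hk hV hN c z
  -- Since `k` and `V` are $C^3$, the field $wv$ is $C^2$, so $g=w^{-1}\nabla\cdot(wv)$ is $C^1$.
  have hgl : LocallyLipschitz g := by
    have h1 : ContDiff ℝ 2 fun z => w z • svgdField k V N z :=
      (hw3.of_le (by norm_num)).smul (contDiff_svgdField hk hV N)
    have h2 : ContDiff ℝ 1 (divergenceOf (configBasis N d) (configCoord N d)
        (fun z => w z • svgdField k V N z)) := by
      refine ContDiff.sum fun p _ => (configCoord N d p).contDiff.comp ?_
      exact (h1.fderiv_right (m := 1) (by norm_num)).clm_apply contDiff_const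
    have h3 : ContDiff ℝ 1 g := by
      have h4 := ((hw3.of_le (by norm_num)).inv fun z => (hwpos z).ne').mul h2
      have h5 : g = fun z => w⁻¹ z * divergenceOf (configBasis N d) (configCoord N d)
          (fun z => w z • svgdField k V N z) z := by
        funext z
        rw [Pi.inv_apply, hdiv, inv_mul_cancel_left₀ (hwpos z).ne']
      rw [h5]
      exact h4
    exact h3.locallyLipschitz
  have hinv := map_flow_withDensity volume h.complete sum_configCoord_smul_configBasis hv1 hgl
    (hw3.of_le (by norm_num)) hdiv (fun z => (hwpos z).le) hwi T
  -- splitting of the Jacobian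
  set q : (Fin N → E d) → ℝ := fun z => N * steinEnergy k V z with hq
  set m : (Fin N → E d) → ℝ := fun z => 1 / (N : ℝ) * max (-S z) 0 with hm
  set r : (Fin N → E d) → ℝ := fun z => 1 / (N : ℝ) * max (S z) 0 with hr
  have hqc : Continuous q := continuous_const.mul hEc
  have hmc : Continuous m := by fun_prop
  have hrc : Continuous r := by fun_prop
  have hq0 : ∀ z, 0 ≤ q z := fun z => mul_nonneg hNpos.le (steinEnergy_nonneg hk z)
  have hm0 : ∀ z, 0 ≤ m z := fun z => by positivity
  have hr0 : ∀ z, 0 ≤ r z := fun z => by positivity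
  have hsplit : ∀ z, flowIntegral h.complete g T z = flowIntegral h.complete q T z +
      flowIntegral h.complete m T z - flowIntegral h.complete r T z := by
    intro z
    have hi : ∀ f : (Fin N → E d) → ℝ, Continuous f →
        IntervalIntegrable (fun s => f (flow h.complete s z)) volume 0 T := fun f hf =>
      (hf.comp (continuous_flow_left h.complete z)).intervalIntegrable _ _
    simp only [flowIntegral]
    rw [← intervalIntegral.integral_add (hi q hqc) (hi m hmc),
      ← intervalIntegral.integral_sub ((hi q hqc).add (hi m hmc)) (hi r hrc)]
    refine intervalIntegral.integral_congr fun s _ => ?_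
    simp only [hg, hq, hm, hr]
    rcases le_total 0 (S (flow h.complete s z)) with h1 | h1
    · rw [max_eq_right (by linarith), max_eq_left h1]
      ring
    · rw [max_eq_left (by linarith), max_eq_right h1]
      ring
  have hI0 : ∀ {f : (Fin N → E d) → ℝ}, (∀ z, 0 ≤ f z) → ∀ z,
      0 ≤ flowIntegral h.complete f T z := fun hf z =>
    intervalIntegral.integral_nonneg hT fun s _ => hf _
  have hIm : ∀ {f : (Fin N → E d) → ℝ}, Continuous f →
      Measurable (flowIntegral h.complete f T) := by
    intro f hf
    have h1 : StronglyMeasurable fun p : (Fin N → E d) × ℝ => f (flow h.complete p.2 p.1) :=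
      (hf.comp ((continuous_flow h.complete hv).comp continuous_swap)).stronglyMeasurable
    have h2 : flowIntegral h.complete f T =
        fun z => ∫ s in Ioc 0 T, f (flow h.complete s z) := by
      funext z
      rw [flowIntegral, intervalIntegral.integral_of_le hT]
    rw [h2]
    exact h1.integral_prod_right.measurable
  -- the initial density relative to the target
  obtain ⟨p₀, hp1, hp0, hpd⟩ := h.density
  have hdm : Measurable fun z => p₀ z / w z :=
    hp1.continuous.measurable.div hw3.continuous.measurable
  have hμ : P.map (x 0) = (Measure.pi fun _ : Fin N => target V).withDensity
      fun z => ENNReal.ofReal (p₀ z / w z) := by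
    rw [hpi, ← withDensity_mul _ hw3.continuous.measurable.ennreal_ofReal
      hdm.ennreal_ofReal, hpd]
    congr 1
    funext z
    rw [Pi.mul_apply, ← ENNReal.ofReal_mul (hwpos z).le, mul_div_cancel₀ _ (hwpos z).ne']
  have hinv' : ((Measure.pi fun _ : Fin N => target V).withDensity fun z => ENNReal.ofReal
      (Real.exp (flowIntegral h.complete q T z + flowIntegral h.complete m T z -
        flowIntegral h.complete r T z))).map (flowEquiv h.complete hv T) =
      Measure.pi fun _ : Fin N => target V := by
    have hgm : Measurable fun z => ENNReal.ofReal (Real.exp (flowIntegral h.complete g T z)) :=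
      (hIm hgl.continuous).exp.ennreal_ofReal
    simp only [← hsplit]
    rw [hpi, ← withDensity_mul _ hw3.continuous.measurable.ennreal_ofReal hgm]
    refine Eq.trans ?_ hinv
    congr 2
    funext z
    rw [Pi.mul_apply, ← ENNReal.ofReal_mul (hwpos z).le, mul_comm]
  have key := klDiv_map_add (flowEquiv h.complete hv T) (hIm hqc) (hIm hmc) (hIm hrc)
    (hI0 hq0) (hI0 hm0) (hI0 hr0) hinv'
    hdm (fun z => div_nonneg (hp0 z) (hwpos z).le) hμ
  rw [h.lintegral_flowIntegral hk hV hqc hq0 hT, h.lintegral_flowIntegral hk hV hmc hm0 hT,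
    h.lintegral_flowIntegral hk hV hrc hr0 hT] at key
  have hmapT : P.map (x T) = (P.map (x 0)).map (flowEquiv h.complete hv T) := h.map_eq hk hV hT
  have hpull : ∀ (a : ℝ≥0∞) (ha : a ≠ ⊤) (f : ℝ → Ω → ℝ≥0∞),
      ∫⁻ t in Icc 0 T, ∫⁻ ω, a * f t ω ∂P = a * ∫⁻ t in Icc 0 T, ∫⁻ ω, f t ω ∂P := by
    intro a ha f
    simp only [lintegral_const_mul' a _ ha]
  have hN1 : ENNReal.ofReal (1 / (N : ℝ)) = (N : ℝ≥0∞)⁻¹ := by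
    rw [one_div, ENNReal.ofReal_inv_of_pos hNpos, ENNReal.ofReal_natCast]
  have hNinv : (N : ℝ≥0∞)⁻¹ ≠ ⊤ := ENNReal.inv_ne_top.2 (by exact_mod_cast (by omega : N ≠ 0))
  have hmax : ∀ a : ℝ, ENNReal.ofReal (max a 0) = ENNReal.ofReal a := fun a => by
    simp [ENNReal.ofReal, Real.toNNReal]
  simp only [hq, hm, hr, ENNReal.ofReal_mul hNpos.le, ENNReal.ofReal_mul (one_div_pos.2 hNpos).le,
    hN1, hmax, ENNReal.ofReal_natCast, hpull _ hNinv, hpull _ (ENNReal.natCast_ne_top N),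
    ← KSD_empirical_sq hk] at key
  rw [← hmapT] at key
  exact key

end Balance

/-! ### Extended-real arithmetic extracting the bounds from the balance -/

section Extended

/-- Dropping `b` gives the first bound, dropping `N * D` the second. The exclusion of
$\infty-\infty$ forces `m` to be finite, since the balance with `m = ⊤` makes its right side
infinite; the other infinite cases have right-hand side `⊤`. -/
theorem two_bounds_of_balance {a b D m p : ℝ≥0∞} {N : ℕ} (hN : 1 ≤ N) {T : ℝ} (hT : 0 < T)
    (h : b + N * D + (N : ℝ≥0∞)⁻¹ * m = a + (N : ℝ≥0∞)⁻¹ * p) (hne : a + p ≠ ⊤ ∨ m ≠ ⊤) :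
    ((1 / T : ℝ) : EReal) * (D : EReal) ≤ ((1 / (N * T) : ℝ) : EReal) * (a : EReal) +
        ((1 / (N ^ 2 * T) : ℝ) : EReal) * ((p : EReal) - (m : EReal)) ∧
      (b : EReal) ≤ (a : EReal) + ((1 / N : ℝ) : EReal) * ((p : EReal) - (m : EReal)) := by
  have hNpos : (0 : ℝ) < N := by exact_mod_cast hN
  have hN0 : (N : ℝ≥0∞) ≠ 0 := by exact_mod_cast (by omega : N ≠ 0)
  have hNinv : (N : ℝ≥0∞)⁻¹ ≠ ⊤ := ENNReal.inv_ne_top.2 hN0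
  have hNinv0 : (N : ℝ≥0∞)⁻¹ ≠ 0 := ENNReal.inv_ne_zero.2 (ENNReal.natCast_ne_top N)
  have hm : m ≠ ⊤ := by
    rcases hne with hne | hne
    · rintro rfl
      rw [ENNReal.mul_top hNinv0, add_top] at h
      exact (ENNReal.add_ne_top.2 ⟨(ENNReal.add_ne_top.1 hne).1,
        ENNReal.mul_ne_top hNinv (ENNReal.add_ne_top.1 hne).2⟩) h.symm
    · exact hne
  have h1 : (0 : ℝ) < 1 / (N * T) := by positivity
  have h2 : (0 : ℝ) < 1 / (N ^ 2 * T) := by positivity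
  have h3 : (0 : ℝ) < 1 / N := by positivity
  lift m to NNReal using hm
  by_cases hp : p = ⊤
  · subst hp
    have h4 : ((⊤ : ℝ≥0∞) : EReal) - ((m : ℝ≥0∞) : EReal) = ⊤ := by
      rw [EReal.coe_ennreal_top]
      exact EReal.top_sub_coe m
    have h5 : ((1 / (N * T) : ℝ) : EReal) * (a : EReal) ≠ ⊥ := by
      refine ne_of_gt (lt_of_lt_of_le EReal.bot_lt_zero ?_)
      exact mul_nonneg (EReal.coe_nonneg.2 h1.le) (EReal.coe_ennreal_nonneg a)
    rw [h4, EReal.coe_mul_top_of_pos h2, EReal.coe_mul_top_of_pos h3, EReal.add_top_of_ne_bot h5,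
      EReal.add_top_of_ne_bot (EReal.coe_ennreal_ne_bot a)]
    exact ⟨le_top, le_top⟩
  lift p to NNReal using hp
  have hpm : (((p : ℝ≥0∞) : EReal) - ((m : ℝ≥0∞) : EReal)) = (((p : ℝ) - (m : ℝ) : ℝ) : EReal) :=
    rfl
  rw [hpm]
  by_cases ha : a = ⊤
  · subst ha
    rw [EReal.coe_ennreal_top, EReal.coe_mul_top_of_pos h1, ← EReal.coe_mul, ← EReal.coe_mul,
      EReal.top_add_coe, EReal.top_add_coe]
    exact ⟨le_top, le_top⟩
  have hR : b + N * D + (N : ℝ≥0∞)⁻¹ * m ≠ ⊤ := by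
    rw [h]
    exact ENNReal.add_ne_top.2 ⟨ha, ENNReal.mul_ne_top hNinv ENNReal.coe_ne_top⟩
  have hb : b ≠ ⊤ := (ENNReal.add_ne_top.1 (ENNReal.add_ne_top.1 hR).1).1
  have hD : D ≠ ⊤ := by
    rintro rfl
    rw [ENNReal.mul_top hN0] at hR
    simp at hR
  lift a to NNReal using ha
  lift b to NNReal using hb
  lift D to NNReal using hD
  have h' : (b : ℝ) + N * D + (N : ℝ)⁻¹ * m = a + (N : ℝ)⁻¹ * p := by
    have := congrArg ENNReal.toReal h
    rwa [ENNReal.toReal_add (ENNReal.add_ne_top.1 hR).1 (ENNReal.add_ne_top.1 hR).2,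
      ENNReal.toReal_add ENNReal.coe_ne_top (ENNReal.add_ne_top.1 (ENNReal.add_ne_top.1 hR).1).2,
      ENNReal.toReal_add ENNReal.coe_ne_top (ENNReal.mul_ne_top hNinv ENNReal.coe_ne_top),
      ENNReal.toReal_mul, ENNReal.toReal_mul, ENNReal.toReal_mul, ENNReal.toReal_inv,
      ENNReal.toReal_natCast] at this
  have hb0 : (0 : ℝ) ≤ b := b.2
  have hD0 : (0 : ℝ) ≤ N * D := mul_nonneg hNpos.le D.2
  have e : ∀ y : NNReal, ((y : ℝ≥0∞) : EReal) = ((y : ℝ) : EReal) := fun _ => rfl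
  simp only [e]
  norm_cast
  rw [show (1 / (N : ℝ)) = (N : ℝ)⁻¹ from one_div _]
  constructor
  · have h6 : N * (D : ℝ) ≤ a + (N : ℝ)⁻¹ * (p - m) := by linarith
    calc 1 / T * (D : ℝ) = 1 / (N * T) * (N * D) := by field_simp
      _ ≤ 1 / (N * T) * (a + (N : ℝ)⁻¹ * (p - m)) := by gcongr
      _ = _ := by push_cast; field_simp
  · linarith

/-- The hypothesis `hpm` encodes $p-m\le N\cdot Nc$ for $c$ of either sign: one factor $N$ is the
length of the time interval, the other the number of particles. -/
theorem rate_of_balance {a b D m p s : ℝ≥0∞} {N : ℕ} (hN : 1 ≤ N) {c : ℝ}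
    (h : b + N * D + (N : ℝ≥0∞)⁻¹ * m = a + (N : ℝ≥0∞)⁻¹ * p) (hp : p ≠ ⊤)
    (hpm : p + N * ENNReal.ofReal (-(N * c)) ≤ m + N * ENNReal.ofReal (N * c))
    (ha : a / N ≤ s) : ((D / N : ℝ≥0∞) : EReal) ≤ ((s : EReal) + c) / (N : EReal) := by
  have hNpos : (0 : ℝ) < N := by exact_mod_cast hN
  have hN0 : (N : ℝ≥0∞) ≠ 0 := by exact_mod_cast (by omega : N ≠ 0)
  have hNinv : (N : ℝ≥0∞)⁻¹ ≠ ⊤ := ENNReal.inv_ne_top.2 hN0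
  have hNinv0 : (N : ℝ≥0∞)⁻¹ ≠ 0 := ENNReal.inv_ne_zero.2 (ENNReal.natCast_ne_top N)
  have hNE : (N : EReal) = ((N : ℝ) : EReal) := rfl
  by_cases hs : s = ⊤
  · subst hs
    rw [EReal.coe_ennreal_top, EReal.top_add_coe, hNE, EReal.top_div_of_pos_ne_top
      (by exact_mod_cast hNpos) (EReal.coe_ne_top _)]
    exact le_top
  have ha' : a ≠ ⊤ := by
    rintro rfl
    rw [ENNReal.top_div_of_ne_top (ENNReal.natCast_ne_top N)] at ha
    exact hs (top_le_iff.1 ha)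
  have hR : b + N * D + (N : ℝ≥0∞)⁻¹ * m ≠ ⊤ := by
    rw [h]
    exact ENNReal.add_ne_top.2 ⟨ha', ENNReal.mul_ne_top hNinv hp⟩
  have hb : b ≠ ⊤ := (ENNReal.add_ne_top.1 (ENNReal.add_ne_top.1 hR).1).1
  have hD : D ≠ ⊤ := by
    rintro rfl
    rw [ENNReal.mul_top hN0] at hR
    simp at hR
  have hm : m ≠ ⊤ := by
    rintro rfl
    rw [ENNReal.mul_top hNinv0] at hR
    simp at hR
  lift a to NNReal using ha'
  lift b to NNReal using hb
  lift D to NNReal using hD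
  lift m to NNReal using hm
  lift p to NNReal using hp
  lift s to NNReal using hs
  have h' : (b : ℝ) + N * D + (N : ℝ)⁻¹ * m = a + (N : ℝ)⁻¹ * p := by
    have := congrArg ENNReal.toReal h
    rwa [ENNReal.toReal_add (ENNReal.add_ne_top.1 hR).1 (ENNReal.add_ne_top.1 hR).2,
      ENNReal.toReal_add ENNReal.coe_ne_top (ENNReal.add_ne_top.1 (ENNReal.add_ne_top.1 hR).1).2,
      ENNReal.toReal_add ENNReal.coe_ne_top (ENNReal.mul_ne_top hNinv ENNReal.coe_ne_top),
      ENNReal.toReal_mul, ENNReal.toReal_mul, ENNReal.toReal_mul, ENNReal.toReal_inv,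
      ENNReal.toReal_natCast] at this
  have hf : ∀ y : ℝ, (N : ℝ≥0∞) * ENNReal.ofReal y ≠ ⊤ := fun y =>
    ENNReal.mul_ne_top (ENNReal.natCast_ne_top N) ENNReal.ofReal_ne_top
  have hpm' : (p : ℝ) ≤ m + N * (N * c) := by
    have h1 := ENNReal.toReal_mono (ENNReal.add_ne_top.2 ⟨ENNReal.coe_ne_top, hf _⟩) hpm
    rw [ENNReal.toReal_add ENNReal.coe_ne_top (hf _), ENNReal.toReal_add ENNReal.coe_ne_top (hf _),
      ENNReal.toReal_mul, ENNReal.toReal_mul, ENNReal.toReal_natCast, ENNReal.toReal_ofReal',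
      ENNReal.toReal_ofReal', ENNReal.coe_toReal, ENNReal.coe_toReal] at h1
    rcases le_total 0 (N * c) with h2 | h2
    · rw [max_eq_right (by linarith), max_eq_left h2] at h1
      linarith
    · rw [max_eq_left (by linarith), max_eq_right h2] at h1
      linarith
  have ha2 : (a : ℝ) / N ≤ s := by
    have h1 := ENNReal.toReal_mono ENNReal.coe_ne_top ha
    rwa [ENNReal.toReal_div, ENNReal.toReal_natCast] at h1
  have hDN : ((D / N : ℝ≥0∞) : EReal) = ((D / N : ℝ) : EReal) := by
    rw [← EReal.coe_toReal (EReal.coe_ennreal_eq_top_iff.not.2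
      (ENNReal.div_ne_top ENNReal.coe_ne_top hN0)) (EReal.coe_ennreal_ne_bot _), EReal.toReal_coe_ennreal, ENNReal.toReal_div,
      ENNReal.toReal_natCast, ENNReal.coe_toReal]
  have e : ((s : ℝ≥0∞) : EReal) = ((s : ℝ) : EReal) := rfl
  rw [hDN, e, hNE, ← EReal.coe_add, ← EReal.coe_div, EReal.coe_le_coe_iff]
  gcongr
  have hb0 : (0 : ℝ) ≤ b := b.2
  have h6 : N * (D : ℝ) ≤ N * (a / N + c) := by
    have h7 : (N : ℝ)⁻¹ * p ≤ (N : ℝ)⁻¹ * m + N * c := by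
      calc (N : ℝ)⁻¹ * p ≤ (N : ℝ)⁻¹ * (m + N * (N * c)) := by gcongr
        _ = _ := by field_simp
    have h8 : N * ((a : ℝ) / N + c) = a + N * c := by field_simp
    linarith
  linarith [le_of_mul_le_mul_left h6 hNpos]

theorem le_ofReal_sqrt_div {I D : ℝ≥0∞} {y r : ℝ} (hr : 0 ≤ r) (h : I ^ 2 ≤ D)
    (hD : (D : EReal) ≤ (y : EReal) / (r : EReal)) : I ≤ ENNReal.ofReal (√y / √r) := by
  rw [← EReal.coe_div] at hD
  have h1 : I ^ 2 ≤ ENNReal.ofReal (y / r) := h.trans <| by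
    rw [← EReal.toENNReal_coe (x := D)]
    refine (EReal.toENNReal_le_toENNReal hD).trans_eq ?_
    rw [EReal.toENNReal_of_ne_top (EReal.coe_ne_top _), EReal.toReal_coe]
  rw [← Real.sqrt_div' _ hr, ← ENNReal.pow_le_pow_left_iff two_ne_zero,
    ← ENNReal.ofReal_pow (Real.sqrt_nonneg _)]
  refine h1.trans ?_
  rcases le_total 0 (y / r) with h0 | h0
  · rw [Real.sq_sqrt h0]
  · rw [ENNReal.ofReal_of_nonpos h0]
    exact zero_le

theorem sq_lintegral_le {α : Type*} [MeasurableSpace α] {μ : Measure α} {f : α → ℝ≥0∞}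
    (hf : AEMeasurable f μ) : (∫⁻ x, f x ∂μ) ^ 2 ≤ μ univ * ∫⁻ x, f x ^ 2 ∂μ := by
  have h := ENNReal.lintegral_mul_le_Lp_mul_Lq μ Real.HolderConjugate.two_two
    (aemeasurable_const (b := (1 : ℝ≥0∞))) hf
  simp only [Pi.mul_apply, one_mul, lintegral_const, ENNReal.rpow_ofNat, one_pow] at h
  refine (pow_le_pow_left' h 2).trans_eq ?_
  rw [mul_pow, ← ENNReal.rpow_mul_natCast, ← ENNReal.rpow_mul_natCast]
  norm_num

end Extended

/-! ### Time averages and the convergence rate -/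

section Rate

variable {d : ℕ} {k : PDKernel (E d)} {V : E d → ℝ} {N : ℕ}

/-- Occupation measures of single particles turn Bochner integrals against the time average into
integrals along the path. -/
theorem timeAverage_eq {γ : ℝ → Fin N → E d} (hγ : ContinuousOn γ (Icc 0 (N : ℝ))) :
    timeAverage γ = (N : ℝ≥0∞)⁻¹ • (N : ℝ≥0∞)⁻¹ •
      ∑ i, (volume.restrict (Icc (0 : ℝ) N)).map fun t => γ t i := by
  have hi : ∀ i, AEMeasurable (fun t => γ t i) (volume.restrict (Icc (0 : ℝ) N)) := fun i =>
    ((continuous_apply i).comp_continuousOn hγ).aemeasurable measurableSet_Icc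
  have hm : Measurable fun z : Fin N → E d => empirical z := by
    refine Measure.measurable_of_measurable_coe _ fun s hs => ?_
    simp only [empirical, Measure.smul_apply, Measure.finsetSum_apply, smul_eq_mul]
    refine measurable_const.mul (Finset.measurable_sum _ fun i _ => ?_)
    exact (Measure.measurable_coe hs).comp (Measure.measurable_dirac.comp (measurable_pi_apply i))
  have hb : AEMeasurable (fun t => empirical (γ t)) (volume.restrict (Icc (0 : ℝ) N)) :=
    hm.comp_aemeasurable (hγ.aemeasurable measurableSet_Icc)
  rw [timeAverage]
  congr 1
  refine Measure.ext fun s hs => ?_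
  rw [Measure.bind_apply hs hb]
  simp only [empirical, Measure.smul_apply, Measure.finsetSum_apply, smul_eq_mul]
  have hd : ∀ i, AEMeasurable (fun t => Measure.dirac (γ t i) s)
      (volume.restrict (Icc (0 : ℝ) N)) := fun i =>
    ((Measure.measurable_coe hs).comp Measure.measurable_dirac).comp_aemeasurable (hi i)
  rw [lintegral_const_mul'' _ (Finset.aemeasurable_fun_sum _ fun i _ => hd i),
    lintegral_finsetSum' _ fun i _ => hd i]
  congr 1
  refine Finset.sum_congr rfl fun i _ => ?_
  rw [← lintegral_indicator_one hs, lintegral_map' (measurable_one.indicator hs).aemeasurable (hi i)]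
  simp only [Measure.dirac_apply' _ hs]

/-- The discrepancy is a supremum of functionals linear in the measure, hence convex. For each fixed
$\phi$ the time integral is exchanged, and the positive part is taken before bounding by the
supremum. -/
theorem KSD_timeAverage_le (hk : ContDiff ℝ 3 fun p : E d × E d => k p.1 p.2)
    (hV : ContDiff ℝ 3 V) (hN : 1 ≤ N) {γ : ℝ → Fin N → E d}
    (hγ : ContinuousOn γ (Icc 0 (N : ℝ))) :
    KSD k V (timeAverage γ) ≤
      (N : ℝ≥0∞)⁻¹ * ∫⁻ t in Icc (0 : ℝ) N, KSD k V (empirical (γ t)) := by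
  have hNpos : (0 : ℝ) < N := by exact_mod_cast hN
  refine iSup₂_le fun φ hφ => ?_
  have hf : Continuous (steinOp V φ.eval) := by
    have h1 : steinOp V φ.eval = fun x => ⟪steinFeature k V x, φ⟫ :=
      funext fun x => steinOp_eval hk φ x
    rw [h1]
    exact (continuous_steinFeature hk hV).inner continuous_const
  set f := steinOp V φ.eval
  have hi : ∀ i, AEMeasurable (fun t => γ t i) (volume.restrict (Icc (0 : ℝ) N)) := fun i =>
    ((continuous_apply i).comp_continuousOn hγ).aemeasurable measurableSet_Icc
  have hint : ∀ i, Integrable (fun t => f (γ t i)) (volume.restrict (Icc (0 : ℝ) N)) := fun i =>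
    (hf.comp_continuousOn ((continuous_apply i).comp_continuousOn hγ)).integrableOn_Icc
  have h2 : ∫ x, f x ∂(timeAverage γ) =
      (N : ℝ)⁻¹ * ∫ t in Icc (0 : ℝ) N, ∫ x, f x ∂(empirical (γ t)) := by
    rw [timeAverage_eq hγ, integral_smul_measure, integral_smul_measure,
      integral_finsetSum_measure fun i _ =>
        (integrable_map_measure hf.aestronglyMeasurable (hi i)).2 (hint i)]
    simp only [integral_empirical]
    rw [integral_const_mul, integral_finsetSum _ fun i _ => hint i]
    simp only [integral_map (hi _) hf.aestronglyMeasurable, ENNReal.toReal_inv,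
      ENNReal.toReal_natCast, smul_eq_mul, one_div]
  have h3 : Integrable (fun t => ∫ x, f x ∂(empirical (γ t)))
      (volume.restrict (Icc (0 : ℝ) N)) := by
    simp only [integral_empirical]
    exact (integrable_finsetSum _ fun i _ => hint i).const_mul _
  rw [h2, ENNReal.ofReal_mul (inv_nonneg.2 hNpos.le), ENNReal.ofReal_inv_of_pos hNpos,
    ENNReal.ofReal_natCast]
  gcongr
  calc ENNReal.ofReal (∫ t in Icc (0 : ℝ) N, ∫ x, f x ∂(empirical (γ t)))
      ≤ ENNReal.ofReal (∫ t in Icc (0 : ℝ) N, max (∫ x, f x ∂(empirical (γ t))) 0) :=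
        ENNReal.ofReal_le_ofReal (integral_mono h3 h3.pos_part fun t => le_max_left _ _)
    _ = ∫⁻ t in Icc (0 : ℝ) N, ENNReal.ofReal (max (∫ x, f x ∂(empirical (γ t))) 0) :=
        ofReal_integral_eq_lintegral_ofReal h3.pos_part (.of_forall fun t => le_max_right _ _)
    _ ≤ ∫⁻ t in Icc (0 : ℝ) N, KSD k V (empirical (γ t)) := by
        refine lintegral_mono fun t => ?_
        refine le_trans (le_of_eq ?_) (le_iSup₂ (f := fun (φ : VecRKHS k) (_ : ‖φ‖ ≤ 1) =>
          ENNReal.ofReal (∫ x, steinOp V φ.eval x ∂(empirical (γ t)))) φ hφ)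
        simp [ENNReal.ofReal, Real.toNNReal, f]

variable {Ω : Type*} [MeasurableSpace Ω] {P : Measure Ω} [IsProbabilityMeasure P]
  {x : ℝ → Ω → Fin N → E d}

/-- Cauchy–Schwarz is used twice: over the initial law, of mass 1, and over $[0,N]$, of mass $N$.
With the prefactor $N^{-2}$ of the squared average this leaves $1/N$. -/
theorem IsSVGD.sq_lintegral_KSD_timeAverage_le
    (hk : ContDiff ℝ 3 fun p : E d × E d => k p.1 p.2) (hV : ContDiff ℝ 3 V) (hN : 1 ≤ N)
    (h : IsSVGD k V N P x) :
    (∫⁻ ω, KSD k V (timeAverage fun t => x t ω) ∂P) ^ 2 ≤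
      ksdSqIntegral k V P x N / (N : ℝ≥0∞) := by
  have hv := locallyLipschitz_svgdField hk hV N
  have hP0 : IsProbabilityMeasure (P.map (x 0)) :=
    Measure.isProbabilityMeasure_map h.aemeasurable_init
  have hN0 : (N : ℝ≥0∞) ≠ 0 := by exact_mod_cast (by omega : N ≠ 0)
  have hNinv : (N : ℝ≥0∞)⁻¹ ≠ ⊤ := ENNReal.inv_ne_top.2 hN0
  have hK := measurable_KSD_empirical hk hV N
  have hKf : Measurable fun p : (Fin N → E d) × ℝ =>
      KSD k V (empirical (flow h.complete p.2 p.1)) :=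
    hK.comp ((continuous_flow h.complete hv).comp continuous_swap).measurable
  set G : (Fin N → E d) → ℝ≥0∞ := fun z =>
    ∫⁻ t in Icc (0 : ℝ) N, KSD k V (empirical (flow h.complete t z)) with hG
  have hGm : Measurable G := hKf.lintegral_prod_right'
  have h1 : ∫⁻ ω, KSD k V (timeAverage fun t => x t ω) ∂P ≤
      (N : ℝ≥0∞)⁻¹ * ∫⁻ z, G z ∂(P.map (x 0)) := by
    rw [lintegral_map' hGm.aemeasurable h.aemeasurable_init, ← lintegral_const_mul' _ _ hNinv]
    refine lintegral_mono_ae ((h.ae_eq_flow hk hV).mono fun ω hω => ?_)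
    have hc : ContinuousOn (fun t => x t ω) (Icc 0 (N : ℝ)) :=
      (continuous_flow_left h.complete (x 0 ω)).continuousOn.congr fun t ht => hω t ht.1
    refine (KSD_timeAverage_le hk hV hN hc).trans_eq ?_
    congr 1
    refine setLIntegral_congr_fun measurableSet_Icc fun t ht => ?_
    simp only [hω t ht.1]
  have h2 : (∫⁻ z, G z ∂(P.map (x 0))) ^ 2 ≤ N * ksdSqIntegral k V P x N := by
    refine (sq_lintegral_le hGm.aemeasurable).trans ?_
    rw [measure_univ, one_mul, ksdSqIntegral, h.lintegral_time hk hV (hK.pow_const 2),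
      ← lintegral_const_mul' _ _ (ENNReal.natCast_ne_top N)]
    refine lintegral_mono fun z => ?_
    refine (sq_lintegral_le (hKf.comp measurable_prodMk_left).aemeasurable).trans_eq ?_
    rw [Measure.restrict_apply_univ, Real.volume_Icc, sub_zero, ENNReal.ofReal_natCast]
    rfl
  calc (∫⁻ ω, KSD k V (timeAverage fun t => x t ω) ∂P) ^ 2
      ≤ ((N : ℝ≥0∞)⁻¹ * ∫⁻ z, G z ∂(P.map (x 0))) ^ 2 := pow_le_pow_left' h1 2
    _ ≤ (N : ℝ≥0∞)⁻¹ ^ 2 * (N * ksdSqIntegral k V P x N) := by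
        rw [mul_pow]
        gcongr
    _ = ksdSqIntegral k V P x N / (N : ℝ≥0∞) := by
        rw [pow_two, mul_assoc, ← mul_assoc _ (N : ℝ≥0∞),
          ENNReal.inv_mul_cancel hN0 (ENNReal.natCast_ne_top N), one_mul, mul_comm, div_eq_mul_inv]

theorem lintegral_lintegral_add_const {T : ℝ} (f : ℝ → Ω → ℝ≥0∞) (c : ℝ≥0∞) :
    ∫⁻ t in Icc 0 T, ∫⁻ ω, f t ω + c ∂P =
      (∫⁻ t in Icc 0 T, ∫⁻ ω, f t ω ∂P) + ENNReal.ofReal T * c := by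
  simp only [lintegral_add_right _ measurable_const, lintegral_const, measure_univ, mul_one,
    Measure.restrict_apply_univ, Real.volume_Icc, sub_zero, mul_comm (ENNReal.ofReal T)]

theorem IsSVGD.ksdSqIntegral_div_le (hk : ContDiff ℝ 3 fun p : E d × E d => k p.1 p.2)
    (hV : ContDiff ℝ 3 V) (hπ : Integrable (fun y => Real.exp (-V y)) volume) (hN : 1 ≤ N)
    (h : IsSVGD k V N P x) {c : ℝ} (hc : ∀ z, Cstar k V z ≤ c) {s : ℝ≥0∞}
    (hs : entropy V P x 0 / N ≤ s) :
    ((ksdSqIntegral k V P x N / (N : ℝ≥0∞) : ℝ≥0∞) : EReal) ≤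
      ((s : EReal) + c) / (N : EReal) := by
  have hS : ∀ t ω, CstarSum k V x t ω ≤ N * c := fun t ω => by
    refine (Finset.sum_le_sum fun i _ => hc (x t ω i)).trans_eq ?_
    simp
  refine rate_of_balance hN (h.entropy_balance hk hV hπ hN (Nat.cast_nonneg N)) ?_ ?_ hs
  · have h1 : posIntegral P N (CstarSum k V x) ≤ ENNReal.ofReal N * ENNReal.ofReal (N * c) := by
      have h2 := lintegral_lintegral_add_const (P := P) (T := N) (fun _ _ => 0) (ENNReal.ofReal (N * c))
      simp only [zero_add, lintegral_zero] at h2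
      rw [← h2]
      exact lintegral_mono fun t => lintegral_mono fun ω => ENNReal.ofReal_le_ofReal (hS t ω)
    exact ne_top_of_le_ne_top (ENNReal.mul_ne_top ENNReal.ofReal_ne_top ENNReal.ofReal_ne_top) h1
  -- Pointwise this is $u^++y^-\le u^-+y^+$, which is $u\le y$ with $u$ the sum of the $C^*$ and
  -- $y=Nc$.
  · rw [← ENNReal.ofReal_natCast N, posIntegral, posIntegral, ENNReal.ofReal_natCast N,
      ← ENNReal.ofReal_natCast N, ← lintegral_lintegral_add_const, ← lintegral_lintegral_add_const]
    refine lintegral_mono fun t => lintegral_mono fun ω => ?_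
    have h1 := hS t ω
    set u := CstarSum k V x t ω
    set y := (N : ℝ) * c
    have e : ∀ a : ℝ, ENNReal.ofReal a = ENNReal.ofReal (max a 0) := fun a => by
      simp [ENNReal.ofReal, Real.toNNReal]
    show ENNReal.ofReal u + ENNReal.ofReal (-y) ≤ ENNReal.ofReal (-u) + ENNReal.ofReal y
    rw [e u, e y, e (-u), e (-y), ← ENNReal.ofReal_add (le_max_right _ _) (le_max_right _ _),
      ← ENNReal.ofReal_add (le_max_right _ _) (le_max_right _ _)]
    refine ENNReal.ofReal_le_ofReal ?_
    have h3 : ∀ a : ℝ, max a 0 - max (-a) 0 = a := fun a => by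
      rcases le_total 0 a with h | h
      · rw [max_eq_left h, max_eq_right (by linarith), sub_zero]
      · rw [max_eq_right h, max_eq_left (by linarith)]
        ring
    linarith [h3 u, h3 y]

end Rate

end SVGD

end

/-! ### The theorem, assembled from the balance and the averaging bound -/

theorem theorem2p1 {d : ℕ} (k : SVGD.PDKernel (SVGD.E d)) (V : SVGD.E d → ℝ)
    (hk : ContDiff ℝ 3 (fun p : SVGD.E d × SVGD.E d => k p.1 p.2))
    (hV : ContDiff ℝ 3 V)
    (hπ : Integrable (fun y => Real.exp (-V y)) volume)
    {Ω : ℕ → Type*} [∀ N, MeasurableSpace (Ω N)]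
    (P : ∀ N, Measure (Ω N)) [∀ N, IsProbabilityMeasure (P N)]
    (x : ∀ N, ℝ → Ω N → Fin N → SVGD.E d) :
    -- the two bounds for a fixed number `N` of particles and a fixed time horizon `T`,
    -- provided that their right-hand sides are not of the form `∞ - ∞`
    (∀ N : ℕ, 1 ≤ N → SVGD.IsSVGD k V N (P N) (x N) → ∀ T : ℝ, 0 < T →
      (SVGD.entropy V (P N) (x N) 0 + SVGD.posIntegral (P N) T (SVGD.CstarSum k V (x N)) ≠ ⊤ ∨
        SVGD.posIntegral (P N) T (fun t ω => -SVGD.CstarSum k V (x N) t ω) ≠ ⊤) →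
      (((1 / T : ℝ) : EReal) * (SVGD.ksdSqIntegral k V (P N) (x N) T : EReal)
          ≤ ((1 / (N * T) : ℝ) : EReal) * (SVGD.entropy V (P N) (x N) 0 : EReal)
            + ((1 / (N ^ 2 * T) : ℝ) : EReal)
              * SVGD.timeExpectation (P N) T (SVGD.CstarSum k V (x N))) ∧
      ((SVGD.entropy V (P N) (x N) T : EReal)
          ≤ (SVGD.entropy V (P N) (x N) 0 : EReal)
            + ((1 / N : ℝ) : EReal)
              * SVGD.timeExpectation (P N) T (SVGD.CstarSum k V (x N)))) ∧
    -- the rate for the time-averaged empirical measures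
    ((∀ N : ℕ, 1 ≤ N → SVGD.IsSVGD k V N (P N) (x N)) →
      (⨆ z : SVGD.E d, (SVGD.Cstar k V z : EReal)) < ⊤ →
      limsup (fun N : ℕ => SVGD.entropy V (P N) (x N) 0 / (N : ℝ≥0∞)) atTop < ⊤ →
      (∀ N : ℕ, 1 ≤ N →
        (∫⁻ ω, SVGD.KSD k V (SVGD.timeAverage fun t => x N t ω) ∂(P N)) ^ 2
            ≤ SVGD.ksdSqIntegral k V (P N) (x N) N / (N : ℝ≥0∞) ∧
        ((SVGD.ksdSqIntegral k V (P N) (x N) N / (N : ℝ≥0∞) : ℝ≥0∞) : EReal)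
            ≤ (((⨆ (L : ℕ) (_ : 1 ≤ L), SVGD.entropy V (P L) (x L) 0 / (L : ℝ≥0∞) : ℝ≥0∞) : EReal)
                + ⨆ z : SVGD.E d, (SVGD.Cstar k V z : EReal)) / (N : EReal)) ∧
      ∃ c : ℝ, ∀ᶠ N : ℕ in atTop,
        ∫⁻ ω, SVGD.KSD k V (SVGD.timeAverage fun t => x N t ω) ∂(P N)
          ≤ ENNReal.ofReal (c / Real.sqrt N)) := by
  refine ⟨fun N hN h T hT hne => SVGD.two_bounds_of_balance hN hT
    (h.entropy_balance hk hV hπ hN hT.le) hne, fun h hC hlim => ?_⟩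
  obtain ⟨c, hc⟩ : ∃ c : ℝ, (⨆ z : SVGD.E d, (SVGD.Cstar k V z : EReal)) = (c : EReal) := by
    refine ⟨_, (EReal.coe_toReal hC.ne (ne_of_gt ?_)).symm⟩
    -- The supremum is a real number: it is not $-\infty$ because it dominates the value at the
    -- origin.
    exact lt_of_lt_of_le (EReal.bot_lt_coe (SVGD.Cstar k V 0))
      (le_iSup (fun z : SVGD.E d => (SVGD.Cstar k V z : EReal)) 0)
  have hcz : ∀ z, SVGD.Cstar k V z ≤ c := fun z => by
    rw [← EReal.coe_le_coe_iff, ← hc]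
    exact le_iSup (fun z : SVGD.E d => (SVGD.Cstar k V z : EReal)) z
  refine ⟨fun N hN => ⟨(h N hN).sq_lintegral_KSD_timeAverage_le hk hV hN, ?_⟩, ?_⟩
  · rw [hc]
    exact (h N hN).ksdSqIntegral_div_le hk hV hπ hN hcz
      (le_iSup₂ (f := fun (L : ℕ) (_ : 1 ≤ L) => SVGD.entropy V (P L) (x L) 0 / (L : ℝ≥0∞)) N hN)
  -- A finite `M` above the limsup replaces the supremum over all $L$, which may be infinite because
  -- finitely many initial entropies are unconstrained.
  · obtain ⟨M, hM, hMtop⟩ := exists_between hlim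
    lift M to NNReal using hMtop.ne
    refine ⟨√(M + c), ?_⟩
    filter_upwards [eventually_lt_of_limsup_lt hM, eventually_ge_atTop 1] with N hNM hN
    exact SVGD.le_ofReal_sqrt_div (Nat.cast_nonneg N)
      ((h N hN).sq_lintegral_KSD_timeAverage_le hk hV hN)
      ((h N hN).ksdSqIntegral_div_le hk hV hπ hN hcz hNM.le)
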